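/- **Notation.** Let $n\ge 2$, let $m$ be Lebesgue measure on $\mathbb R^n$, and let $\overline{\mathbb R^n}=\mathbb R^n\cup\{\infty\}$ with its usual (one-point compactification) topology. A path is a continuous map $\gamma:\Delta\to\mathbb R^n$ of a nondegenerate interval $\Delta\subset\mathbb R$; it is locally rectifiable if all its closed subpaths have finite length. A Borel function $\rho:\mathbb R^n\to[0,\infty]$ is admissible for a family $\Gamma$ of paths if $\int_\gamma\rho\,|dx|\ge 1$ for all locally rectifiable $\gamma\in\Gamma$, and $M_p(\Gamma)=\inf_\rho\int_{\mathbb R^n}\rho^p\,dm$ over admissible $\rho$ ($p\ge 1$). A property holds for $p$-a.e. path if the paths for which it fails form a family of zero $p$-modulus. For a locally rectifiable $\gamma$ let $l_\gamma$ be its length function (signed length measured from a fixed parameter) and $\Delta_\gamma=l_\gamma(\Delta)$; if $g\circ\gamma$ is also locally rectifiable, $L_{\gamma,g}:\Delta_\gamma\to\Delta_{g\circ\gamma}$ is defined by $L_{\gamma,g}(l_\gamma(t))=l_{g\circ\gamma}(t)$. A map has the $N$-property if images of null sets are null, and the $N^{-1}$-property if preimages of null sets are null. A map $f:G\to\mathbb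 R^n$ of an open set $G\subset\mathbb R^n$ has *finite length $(p,q)$-distortion* if it is differentiable a.e. in $G$, has the $N$- and $N^{-1}$-properties, and: for $p$-a.e. path $\gamma$ in $G$, $f\circ\gamma$ is locally rectifiable and $L_{\gamma,f}$ has the $N$-property; and for $q$-a.e. path $\beta$ in $f(G)$, each path $\gamma$ in $G$ with $f\circ\gamma=\beta$ is locally rectifiable and $L_{\gamma,f}$ has the $N^{-1}$-property. Put $K_{O,p}(x,f)=\|f'(x)\|^p/|J(x,f)|$ if $J(x,f)=\det f'(x)\ne0$, $K_{O,p}(x,f)=1$ if $f'(x)=0$, and $K_{O,p}(x,f)=\infty$ otherwise. For a set $S$ put $$K_{I,p}(y,f^{-1},S)=\sum_{x\in S,\ f(x)=y}K_{O,p}(x,f),\qquad N(y,f,S)=\operatorname{card}\{x\in S: f(x)=y\}.$$ **Theorem.** Let $D\subset\mathbb R^n$, $n\ge2$, be a domain, $x_0\in D$, $p\ge n$, $q\ge1$, and let $f:D\setminus\{x_0\}\to\mathbb R^n$ be a continuous open discrete mapping with finite length $(p,q)$-distortion. Suppose that for some $c>0$, $K_{I,p}(y,f^{-1},D\setminus\{x_0\})\ge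 c$ for a.e. $y\in f(D\setminus\{x_0\})$. Suppose that $x_0$ is an essential singularity of $f$, i.e. $f(x)$ has no limit in $\overline{\mathbb R^n}$ as $x\to x_0$. Let $C(x_0,f)\subset\overline{\mathbb R^n}$ be the cluster set of $f$ at $x_0$, i.e. the set of all limits of $f(x_k)$ along sequences $x_k\to x_0$ in $D\setminus\{x_0\}$. Then for every $y_0\in C(x_0,f)$ and every neighbourhood $U$ of $y_0$ in $\overline{\mathbb R^n}$, $$\int_{U\cap\mathbb R^n}K_{I,p}(y,f^{-1},D\setminus\{x_0\})\,dm(y)=\infty .$$ In particular, let $V\subset D$ be a neighbourhood of $x_0$ (for instance $V=D$) and let $Q:\mathbb R^n\to[0,\infty]$ be a Lebesgue measurable function that is integrable on some neighbourhood $U$ of some point $y_0\in C(x_0,f)$. If $$K_{I,p}(y,f^{-1},V\setminus\{x_0\})\le Q(y)\,N(y,f,V\setminus\{x_0\})\quad\text{for a.e. } y\in f(V\setminus\{x_0\}),$$ then $y\mapsto N(y,f,V\setminus\{x_0\})$ is unbounded. -/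

import Mathlib

open Set Filter Topology MeasureTheory
open scoped ENNReal

noncomputable section

/-- A path in `E`: a continuous map on a nondegenerate interval `dom ⊆ ℝ` of any kind (open,
half-open, closed, bounded or not).  Only the values of `toFun` on `dom` matter. -/
structure IntervalPath (E : Type*) [TopologicalSpace E] where
  dom : Set ℝ
  toFun : ℝ → E
  ordConnected : dom.OrdConnected
  nontrivial : dom.Nontrivial
  continuousOn : ContinuousOn toFun dom

namespace IntervalPath

/-- The path lies in the set `S`. -/
def LiesIn {E : Type*} [TopologicalSpace E] (γ : IntervalPath E) (S : Set E) : Prop :=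
  MapsTo γ.toFun γ.dom S

/-- The parameter `t₀` at which the length function is normalized to vanish. -/
def base {E : Type*} [TopologicalSpace E] (γ : IntervalPath E) : ℝ :=
  γ.nontrivial.nonempty.some

theorem base_mem {E : Type*} [TopologicalSpace E] (γ : IntervalPath E) : γ.base ∈ γ.dom :=
  γ.nontrivial.nonempty.some_mem

/-- Local rectifiability: every closed subpath has finite length. -/
def LocRect {E : Type*} [PseudoEMetricSpace E] (γ : IntervalPath E) : Prop :=
  LocallyBoundedVariationOn γ.toFun γ.dom

/-- The length function `l_γ`: signed length of the subpath between `t₀` and `t`. -/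
def len {E : Type*} [PseudoEMetricSpace E] (γ : IntervalPath E) (t : ℝ) : ℝ :=
  variationOnFromTo γ.toFun γ.dom γ.base t

/-- The length interval `Δ_γ = l_γ(Δ)`. -/
def lenDom {E : Type*} [PseudoEMetricSpace E] (γ : IntervalPath E) : Set ℝ :=
  γ.len '' γ.dom

/-- The arc-length parametrization of `γ`, defined on `γ.lenDom`. -/
def arc {E : Type*} [PseudoEMetricSpace E] (γ : IntervalPath E) : ℝ → E :=
  naturalParameterization γ.toFun γ.dom γ.base

/-- The line integral `∫_γ ρ |dx|` along a locally rectifiable path. -/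
def lineIntegral {E : Type*} [PseudoEMetricSpace E] (γ : IntervalPath E) (ρ : E → ℝ≥0∞) : ℝ≥0∞ :=
  ∫⁻ s in γ.lenDom, ρ (γ.arc s)

/-- Local rectifiability of the image path `f ∘ γ`. -/
def ImageLocRect {E F : Type*} [TopologicalSpace E] [PseudoEMetricSpace F]
    (γ : IntervalPath E) (f : E → F) : Prop :=
  LocallyBoundedVariationOn (f ∘ γ.toFun) γ.dom

/-- The function `L_{γ,f}` on `γ.lenDom`, determined by `L_{γ,f}(l_γ(t)) = l_{f∘γ}(t)` for
`t` in the parameter interval of `γ`. -/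
def lenTransfer {E F : Type*} [PseudoEMetricSpace E] [PseudoEMetricSpace F]
    (γ : IntervalPath E) (f : E → F) (s : ℝ) : ℝ :=
  variationOnFromTo (f ∘ γ.toFun) γ.dom γ.base (Function.invFunOn γ.len γ.dom s)

/-- `arc` is the arc-length parametrization: `γ = arc ∘ l_γ`. -/
theorem arc_len {E : Type*} [MetricSpace E] (γ : IntervalPath E) (hγ : γ.LocRect)
    {t : ℝ} (ht : t ∈ γ.dom) : γ.arc (γ.len t) = γ.toFun t :=
  edist_eq_zero.1 (edist_naturalParameterization_eq_zero hγ γ.base_mem ht)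

/-- The defining identity of `L_{γ,f}`. -/
theorem lenTransfer_len {E F : Type*} [MetricSpace E] [MetricSpace F]
    (γ : IntervalPath E) (f : E → F) (hγ : γ.LocRect) (hf : γ.ImageLocRect f)
    {t : ℝ} (ht : t ∈ γ.dom) :
    γ.lenTransfer f (γ.len t) = variationOnFromTo (f ∘ γ.toFun) γ.dom γ.base t := by
  have hex : ∃ u ∈ γ.dom, γ.len u = γ.len t := ⟨t, ht, rfl⟩
  have hu := Function.invFunOn_mem hex
  have he := Function.invFunOn_eq hex
  unfold lenTransfer
  set u := Function.invFunOn γ.len γ.dom (γ.len t)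
  have hz : variationOnFromTo γ.toFun γ.dom u t = 0 :=
    (variationOnFromTo.eq_left_iff hγ γ.base_mem hu ht).1 he
  refine (variationOnFromTo.eq_left_iff hf γ.base_mem hu ht).2 ?_
  rw [variationOnFromTo.eq_zero_iff hγ hu ht] at hz
  rw [variationOnFromTo.eq_zero_iff hf hu ht]
  intro x hx y hy
  have hxy : γ.toFun x = γ.toFun y := edist_eq_zero.1 (hz hx hy)
  simp [hxy]

end IntervalPath

/-- `ρ` is admissible for the family `Γ`: it is Borel and `∫_γ ρ |dx| ≥ 1` for every locally
rectifiable `γ ∈ Γ`. -/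
def IsAdmissible {E : Type*} [PseudoEMetricSpace E] [MeasurableSpace E]
    (ρ : E → ℝ≥0∞) (Γ : Set (IntervalPath E)) : Prop :=
  Measurable ρ ∧ ∀ γ ∈ Γ, γ.LocRect → 1 ≤ γ.lineIntegral ρ

/-- The `p`-modulus `M_p(Γ)`. -/
def pModulus {E : Type*} [PseudoEMetricSpace E] [MeasureSpace E]
    (p : ℝ) (Γ : Set (IntervalPath E)) : ℝ≥0∞ :=
  ⨅ (ρ : E → ℝ≥0∞) (_ : IsAdmissible ρ Γ), ∫⁻ x, (ρ x) ^ p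

/-- Luzin's `N`-property of `g` on `S`: images of null subsets of `S` are null. -/
def LuzinNOn {X Y : Type*} [MeasureSpace X] [MeasureSpace Y] (g : X → Y) (S : Set X) : Prop :=
  ∀ A ⊆ S, volume A = 0 → volume (g '' A) = 0

/-- The `N⁻¹`-property of `g` on `S`: preimages in `S` of null sets are null. -/
def LuzinNInvOn {X Y : Type*} [MeasureSpace X] [MeasureSpace Y] (g : X → Y) (S : Set X) : Prop :=
  ∀ B : Set Y, volume B = 0 → volume (S ∩ g ⁻¹' B) = 0

/-- Property `L⁽¹⁾_p` of `f : G → F`: for `p`-almost every path `γ` in `G`, the path `f ∘ γ` is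
locally rectifiable and `L_{γ,f}` has the `N`-property. -/
def LOne {E F : Type*} [PseudoEMetricSpace E] [MeasureSpace E] [PseudoEMetricSpace F]
    (p : ℝ) (f : E → F) (G : Set E) : Prop :=
  pModulus p {γ : IntervalPath E | γ.LiesIn G ∧
    ¬ (γ.LocRect ∧ γ.ImageLocRect f ∧ LuzinNOn (γ.lenTransfer f) γ.lenDom)} = 0

/-- `γ` is a (whole) lifting of `β` under `f : G → F`: a path in `G` with `f ∘ γ = β`. -/
def IsLifting {E F : Type*} [TopologicalSpace E] [TopologicalSpace F]
    (f : E → F) (G : Set E) (γ : IntervalPath E) (β : IntervalPath F) : Prop :=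
  γ.LiesIn G ∧ γ.dom = β.dom ∧ EqOn (f ∘ γ.toFun) β.toFun β.dom

/-- Property `L⁽²⁾_q` of `f : G → F`: for `q`-almost every path `β` in `f(G)`, each lifting `γ` of
`β` is locally rectifiable and `L_{γ,f}` has the `N⁻¹`-property. -/
def LTwo {E F : Type*} [PseudoEMetricSpace E] [PseudoEMetricSpace F] [MeasureSpace F]
    (q : ℝ) (f : E → F) (G : Set E) : Prop :=
  pModulus q {β : IntervalPath F | β.LiesIn (f '' G) ∧
    ¬ (β.LocRect ∧ ∀ γ : IntervalPath E, IsLifting f G γ β →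
      γ.LocRect ∧ LuzinNInvOn (γ.lenTransfer f) γ.lenDom)} = 0

/-- `f : G → ℝⁿ` (`G ⊆ ℝⁿ` open) has finite length `(p, q)`-distortion. -/
structure FiniteLengthDistortion {n : ℕ} (p q : ℝ)
    (f : EuclideanSpace ℝ (Fin n) → EuclideanSpace ℝ (Fin n))
    (G : Set (EuclideanSpace ℝ (Fin n))) : Prop where
  ae_differentiable : ∀ᵐ x, x ∈ G → DifferentiableAt ℝ f x
  luzinN : LuzinNOn f G
  luzinNInv : LuzinNInvOn f G
  lOne : LOne p f G
  lTwo : LTwo q f G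

/-- `f` is an open discrete (continuous) mapping of the open set `G`: images of open subsets of `G`
are open, and every fibre in `G` consists of isolated points. -/
structure OpenDiscreteOn {E F : Type*} [TopologicalSpace E] [TopologicalSpace F]
    (f : E → F) (G : Set E) : Prop where
  continuousOn : ContinuousOn f G
  isOpen_image : ∀ U ⊆ G, IsOpen U → IsOpen (f '' U)
  discrete : ∀ y, IsDiscrete (G ∩ f ⁻¹' {y})

open Classical in
/-- The outer dilatation `K_{O,p}(x, f)`: `‖f'(x)‖^p / |J(x, f)|` if `J(x, f) ≠ 0`, `1` if
`f'(x) = 0`, and `∞` in all other cases. -/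
def outerDil {n : ℕ} (p : ℝ) (f : EuclideanSpace ℝ (Fin n) → EuclideanSpace ℝ (Fin n))
    (x : EuclideanSpace ℝ (Fin n)) : ℝ≥0∞ :=
  if DifferentiableAt ℝ f x then
    if (fderiv ℝ f x).det ≠ 0 then
      ENNReal.ofReal (‖fderiv ℝ f x‖ ^ p / |(fderiv ℝ f x).det|)
    else if fderiv ℝ f x = 0 then 1 else ∞
  else ∞

/-- `K_{I,p}(y, f⁻¹, S) = ∑_{x ∈ S ∩ f⁻¹(y)} K_{O,p}(x, f)`. -/
def innerDil {n : ℕ} (p : ℝ) (f : EuclideanSpace ℝ (Fin n) → EuclideanSpace ℝ (Fin n))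
    (S : Set (EuclideanSpace ℝ (Fin n))) (y : EuclideanSpace ℝ (Fin n)) : ℝ≥0∞ :=
  ∑' x : ↥(S ∩ f ⁻¹' {y}), outerDil p f x

/-- The multiplicity `N(y, f, S) = card {x ∈ S : f(x) = y}`. -/
def mapMultiplicity {E F : Type*} (f : E → F) (S : Set E) (y : F) : ℕ∞ :=
  (S ∩ f ⁻¹' {y}).encard

/-- The cluster set `C(x₀, f)` of `f : G → F` in the one-point compactification of `F`. -/
def clusterSet {E F : Type*} [TopologicalSpace E] [TopologicalSpace F]
    (f : E → F) (G : Set E) (x₀ : E) : Set (OnePoint F) :=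
  {y | ∃ u : ℕ → E, (∀ k, u k ∈ G) ∧ Tendsto u atTop (𝓝 x₀) ∧
    Tendsto (fun k => (f (u k) : OnePoint F)) atTop (𝓝 y)}

/-- The isolated singularity `x₀` of `f` is essential: `f` has no limit at `x₀` in the one-point
compactification of `F`, i.e. no continuous extension to `x₀`, finite or infinite. -/
def IsEssentialSingularity {E F : Type*} [TopologicalSpace E] [TopologicalSpace F]
    (f : E → F) (x₀ : E) : Prop :=
  ¬ ∃ z : OnePoint F, Tendsto (fun x => (f x : OnePoint F)) (𝓝[≠] x₀) (𝓝 z)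

end

/-!
Suppose that the integral of `K_I` over a neighbourhood `U` of a cluster value `y₀` is finite, and
let `T ⊆ U` be a closed ball about `y₀` or, if `y₀ = ∞`, the complement of a large open ball. Then
`f` has a limit at `x₀`, so that the singularity is not essential. Throughout, `P` is a punctured
cube about `x₀`.

*Change of variables.* As `f` is differentiable almost everywhere and the set `{J = 0}` is null by
Sard's theorem and the `N⁻¹`-property, `∫_{P ∩ f⁻¹T} ‖f'‖ᵖ ≤ ∫_T K_I < ∞`
(`lintegral_derivNorm_rpow_le_lintegral_innerDil`). With `|J| ≤ ‖f'‖ⁿ ≤ 1 + ‖f'‖ᵖ` and the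
`N`-property it follows that the images of small punctured cubes fill arbitrarily little of `T`
(`exists_volume_image_puncturedCube_inter_lt`).

*Upper gradients.* Let `w` be `1`-Lipschitz and locally constant off `T`. On a segment outside the
exceptional family of `L⁽¹⁾_p`, the function `w ∘ f` is of bounded variation with Luzin's property,
hence it varies by at most the integral of `‖f'‖` over the part of the segment that `f` maps to `T`.
The exceptional family has zero modulus, so some `h ∈ Lᵖ` has infinite integral along all its
members, and `g = ‖f'‖ + h` is an upper gradient of `w ∘ f` along all segments
(`exists_isSegmentUpperGradient`). Here `g ∈ Lⁿ(P)` because `p ≥ n`.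

*Oscillation.* Morrey's estimate on the `(n-1)`-dimensional faces of cubes, whose exponent
`n` exceeds the dimension, bounds the oscillation of `w ∘ f` on the boundary of the cube of half
side `t` in terms of `t ∫ gⁿ` over that boundary. The energies are integrable in `t` while
`∫₀ dt/t = ∞`, so the oscillation is small for some arbitrarily small `t`
(`frequently_abs_sub_le`). This holds for all admissible `w` with the same `t`.

*Conclusion.* Apply this to the truncated distance from `y₀` (or to `max ‖·‖ r`, if `y₀ = ∞`).
Either the boundaries of arbitrarily small cubes are mapped well inside a bounded set; by the
maximum principle for open maps `f` is then bounded near `x₀`, which is absurd for `y₀ = ∞`, and for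
finite `y₀` gives small oscillation of `f` itself, and so a limit. Or the images of these boundaries
miss a ball `S`. If `S` contains values of `f` taken arbitrarily close to `x₀`, then,
being connected, it is covered by the image of each small punctured cube, which contradicts the
volume bound on `T` (`false_of_frequently_notMem`).
-/

open scoped NNReal

/-! ### Exceptional families of paths -/

/-- A family of zero modulus is negligible for a single weight: some `ρ ∈ Lᵖ` has infinite
integral along every locally rectifiable member (Fuglede). -/
theorem exists_lintegral_rpow_lt_top_of_pModulus_eq_zero {E : Type*} [PseudoEMetricSpace E]
    [MeasureSpace E] {p : ℝ} (hp : 0 < p) {Γ : Set (IntervalPath E)} (h : pModulus p Γ = 0) :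
    ∃ ρ : E → ℝ≥0∞, Measurable ρ ∧ ∫⁻ x, ρ x ^ p < ∞ ∧
      ∀ γ ∈ Γ, γ.LocRect → γ.lineIntegral ρ = ∞ := by
  obtain ⟨ε, hε0, hε⟩ := ENNReal.exists_pos_sum_of_countable' (one_ne_zero (α := ℝ≥0∞)) ℕ
  have hk : ∀ k : ℕ, ((k : ℝ≥0∞) + 1) ^ p ≠ ∞ := fun k =>
    ENNReal.rpow_ne_top_of_nonneg hp.le (by finiteness)
  have hk0 : ∀ k : ℕ, ((k : ℝ≥0∞) + 1) ^ p ≠ 0 := fun k => by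
    simp [ENNReal.rpow_eq_zero_iff]
  have hex : ∀ k : ℕ, ∃ ρ : E → ℝ≥0∞, IsAdmissible ρ Γ ∧
      ∫⁻ x, ρ x ^ p < ε k / ((k : ℝ≥0∞) + 1) ^ p := by
    intro k
    have hpos : pModulus p Γ < ε k / ((k : ℝ≥0∞) + 1) ^ p := by
      rw [h]
      exact ENNReal.div_pos (hε0 k).ne' (hk k)
    simpa only [pModulus, iInf_lt_iff, exists_prop] using hpos
  choose ρ hρ hρε using hex
  have hm : ∀ k : ℕ, Measurable fun x => (((k : ℝ≥0∞) + 1) * ρ k x) ^ p := fun k =>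
    ((hρ k).1.const_mul _).pow_const p
  refine ⟨fun x => (∑' k : ℕ, (((k : ℝ≥0∞) + 1) * ρ k x) ^ p) ^ p⁻¹,
    (Measurable.tsum hm).pow_const _, ?_, ?_⟩
  · have h1 : ∀ x, ((∑' k : ℕ, (((k : ℝ≥0∞) + 1) * ρ k x) ^ p) ^ p⁻¹) ^ p =
        ∑' k : ℕ, (((k : ℝ≥0∞) + 1) * ρ k x) ^ p := fun x => ENNReal.rpow_inv_rpow hp.ne' _
    simp_rw [h1]
    rw [lintegral_tsum fun k => (hm k).aemeasurable]
    refine lt_of_le_of_lt (ENNReal.tsum_le_tsum fun k => ?_) (hε.trans ENNReal.one_lt_top)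
    simp_rw [ENNReal.mul_rpow_of_nonneg _ _ hp.le]
    rw [lintegral_const_mul _ ((hρ k).1.pow_const p)]
    calc _ ≤ ((k : ℝ≥0∞) + 1) ^ p * (ε k / ((k : ℝ≥0∞) + 1) ^ p) := by gcongr; exact (hρε k).le
      _ = ε k := ENNReal.mul_div_cancel (hk0 k) (hk k)
  · intro γ hγ hr
    refine ENNReal.eq_top_of_forall_nnreal_le fun r => ?_
    obtain ⟨k, hkr⟩ := exists_nat_ge r
    calc (r : ℝ≥0∞) ≤ (k : ℝ≥0∞) + 1 := by
            refine le_trans ?_ le_self_add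
            exact_mod_cast hkr
      _ ≤ ((k : ℝ≥0∞) + 1) * γ.lineIntegral (ρ k) := le_mul_of_one_le_right' ((hρ k).2 γ hγ hr)
      _ = ∫⁻ s in γ.lenDom, ((k : ℝ≥0∞) + 1) * ρ k (γ.arc s) :=
            (lintegral_const_mul' _ _ (by finiteness)).symm
      _ ≤ _ := by
            refine lintegral_mono fun s => ?_
            dsimp only
            rw [ENNReal.le_rpow_inv_iff hp]
            exact ENNReal.le_tsum (f := fun k : ℕ => (((k : ℝ≥0∞) + 1) * ρ k (γ.arc s)) ^ p) k

/-! ### Length functions of unit speed paths -/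

theorem Isometry.hasUnitSpeedOn {E : Type*} [PseudoEMetricSpace E] {γ : ℝ → E} (hγ : Isometry γ)
    (s : Set ℝ) : HasUnitSpeedOn γ s := by
  rw [HasUnitSpeedOn, hasConstantSpeedOnWith_iff_ordered]
  intro x hx y hy _
  have : eVariationOn γ (s ∩ Icc x y) = eVariationOn id (s ∩ Icc x y) := by
    simp only [eVariationOn, hγ.edist_eq, id]
  rw [this, eVariationOn_id hx hy, NNReal.coe_one, one_mul]

namespace IntervalPath

section Isometry

variable {E : Type*} [MetricSpace E] {γ : IntervalPath E}

theorem locRect_of_isometry (hγ : Isometry γ.toFun) : γ.LocRect :=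
  (hγ.hasUnitSpeedOn γ.dom).hasLocallyBoundedVariationOn

theorem len_of_isometry (hγ : Isometry γ.toFun) {t : ℝ} (ht : t ∈ γ.dom) :
    γ.len t = t - γ.base := by
  have := (hasConstantSpeedOnWith_iff_variationOnFromTo_eq.1 (hγ.hasUnitSpeedOn γ.dom)).2
    γ.base_mem ht
  simpa [len] using this

theorem lineIntegral_of_isometry (hγ : Isometry γ.toFun) (ρ : E → ℝ≥0∞) :
    γ.lineIntegral ρ = ∫⁻ t in γ.dom, ρ (γ.toFun t) := by
  have hd : γ.lenDom = (fun t => t - γ.base) '' γ.dom :=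
    image_congr fun t ht => len_of_isometry hγ ht
  have hmd : MeasurableSet γ.dom := γ.ordConnected.measurableSet
  have hemb : MeasurableEmbedding fun t : ℝ => t - γ.base := measurableEmbedding_subRight _
  have hmp : MeasurePreserving (fun t : ℝ => t - γ.base) := measurePreserving_sub_right _ _
  have hpre : (fun t : ℝ => t - γ.base) ⁻¹' γ.lenDom = γ.dom := by
    rw [hd]; exact hemb.injective.preimage_image _
  rw [lineIntegral, ← hmp.setLIntegral_comp_preimage_emb hemb, hpre]
  refine setLIntegral_congr_fun hmd fun t ht => ?_
  rw [← len_of_isometry hγ ht, arc_len γ (locRect_of_isometry hγ) ht]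

end Isometry

end IntervalPath

/-! ### The upper gradient inequality along segments -/

/-- One half of the Banach–Zarecki theorem: a continuous function of bounded variation with
Luzin's property grows by at most the integral of its derivative. -/
theorem ofReal_abs_sub_le_lintegral_of_luzinNOn {v : ℝ → ℝ} {a b : ℝ} (hab : a ≤ b)
    (hc : ContinuousOn v (Icc a b)) (hbv : LocallyBoundedVariationOn v (Icc a b))
    (hN : LuzinNOn v (Icc a b)) {g : ℝ → ℝ≥0∞}
    (hg : ∀ᵐ s, s ∈ Ioo a b → DifferentiableAt ℝ v s → ENNReal.ofReal |deriv v s| ≤ g s) :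
    ENNReal.ofReal |v b - v a| ≤ ∫⁻ s in Icc a b, g s := by
  set S : Set ℝ := Ioo a b ∩ {s | DifferentiableAt ℝ v s} with hS
  have hSm : MeasurableSet S := measurableSet_Ioo.inter (measurableSet_of_differentiableAt ℝ v)
  have hnull : volume (Icc a b \ S) = 0 := by
    have h1 : ∀ᵐ s, s ∈ Icc a b → s ∈ S := by
      have ha : ∀ᵐ s : ℝ, s ≠ a := by simp [ae_iff, measure_singleton]
      have hb : ∀ᵐ s : ℝ, s ≠ b := by simp [ae_iff, measure_singleton]
      filter_upwards [hbv.ae_differentiableWithinAt_of_mem, ha, hb] with s hs hsa hsb hsm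
      have hso : s ∈ Ioo a b := ⟨lt_of_le_of_ne hsm.1 hsa.symm, lt_of_le_of_ne hsm.2 hsb⟩
      exact ⟨hso, (hs hsm).differentiableAt (Icc_mem_nhds hso.1 hso.2)⟩
    rw [ae_iff] at h1
    refine measure_mono_null (fun s hs => ?_) h1
    simpa [mem_ofPred_eq, and_assoc] using hs
  have hsub : uIcc (v a) (v b) ⊆ v '' S ∪ v '' (Icc a b \ S) := by
    rw [← image_union]
    refine (intermediate_value_uIcc (by rwa [uIcc_of_le hab])).trans (image_mono ?_)
    rw [uIcc_of_le hab]
    intro s hs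
    by_cases h : s ∈ S
    · exact Or.inl h
    · exact Or.inr ⟨hs, h⟩
  calc ENNReal.ofReal |v b - v a| = volume (uIcc (v a) (v b)) := Real.volume_interval.symm
    _ ≤ volume (v '' S) + volume (v '' (Icc a b \ S)) :=
        (measure_mono hsub).trans (measure_union_le _ _)
    _ = volume (v '' S) := by rw [hN _ sdiff_subset hnull, add_zero]
    _ ≤ ∫⁻ s in S, ENNReal.ofReal |(fderiv ℝ v s).det| :=
        addHaar_image_le_lintegral_abs_det_fderiv volume hSm
          fun s hs => hs.2.hasFDerivAt.hasFDerivWithinAt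
    _ ≤ ∫⁻ s in S, g s := by
        refine lintegral_mono_ae ((ae_restrict_iff' hSm).2 ?_)
        filter_upwards [hg] with s hs hsS
        have hdet : (fderiv ℝ v s).det = deriv v s := by
          simp [ContinuousLinearMap.det]
        rw [hdet]
        exact hs hsS.1 hsS.2
    _ ≤ ∫⁻ s in Icc a b, g s := lintegral_mono_set fun s hs => Ioo_subset_Icc_self hs.1

/-- A `1`-Lipschitz image of a null set of reals is null, also when the two sets are only related
by a common parametrization. -/
theorem volume_image_eq_zero_of_dist_le {V v : ℝ → ℝ} {A : Set ℝ}
    (h : ∀ s ∈ A, ∀ t ∈ A, dist (v s) (v t) ≤ dist (V s) (V t)) (hV : volume (V '' A) = 0) :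
    volume (v '' A) = 0 := by
  have hex : ∀ y ∈ V '' A, ∃ s ∈ A, V s = y := fun y hy => hy
  choose! σ hσA hσ using hex
  have hL : LipschitzOnWith 1 (v ∘ σ) (V '' A) := by
    refine LipschitzOnWith.of_dist_le_mul fun y hy z hz => ?_
    have := h _ (hσA y hy) _ (hσA z hz)
    simpa [hσ y hy, hσ z hz] using this
  have himg : v '' A ⊆ (v ∘ σ) '' (V '' A) := by
    rintro _ ⟨s, hs, rfl⟩
    refine ⟨V s, mem_image_of_mem V hs, dist_le_zero.1 ?_⟩
    have h1 := h _ (hσA _ (mem_image_of_mem V hs)) _ hs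
    simpa [hσ _ (mem_image_of_mem V hs)] using h1
  have h2 := hL.hausdorffMeasure_image_le (d := 1) zero_le_one
  rw [hausdorffMeasure_real, hV] at h2
  exact measure_mono_null himg (by simpa using h2)

/-- The bound `|(w ∘ f ∘ γ)'| ≤ ‖f'‖` for `1`-Lipschitz `w` and `γ`; no derivative of `w` or `γ`
is needed. -/
theorem abs_deriv_comp_le_norm_fderiv {E F : Type*} [NormedAddCommGroup E] [NormedSpace ℝ E]
    [NormedAddCommGroup F] [NormedSpace ℝ F] {f : E → F} {w : F → ℝ} {γ : ℝ → E}
    (hw : LipschitzWith 1 w) (hγ : Isometry γ) {s : ℝ} (hf : DifferentiableAt ℝ f (γ s))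
    (hv : DifferentiableAt ℝ (fun t => w (f (γ t))) s) :
    |deriv (fun t => w (f (γ t))) s| ≤ ‖fderiv ℝ f (γ s)‖ := by
  refine le_of_forall_pos_le_add fun ε hε => ?_
  rw [← Real.norm_eq_abs, norm_deriv_eq_norm_fderiv]
  refine hv.hasFDerivAt.le_of_lip' (by positivity) ?_
  have h1 := hγ.continuous.continuousAt.eventually (hf.hasFDerivAt.isLittleO.def hε)
  filter_upwards [h1] with t ht
  have hn : ‖γ t - γ s‖ = ‖t - s‖ := by rw [← dist_eq_norm, hγ.dist_eq, dist_eq_norm]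
  calc ‖w (f (γ t)) - w (f (γ s))‖ ≤ ‖f (γ t) - f (γ s)‖ := by
        simpa [dist_eq_norm] using hw.dist_le_mul (f (γ t)) (f (γ s))
    _ ≤ ‖f (γ t) - f (γ s) - fderiv ℝ f (γ s) (γ t - γ s)‖ + ‖fderiv ℝ f (γ s) (γ t - γ s)‖ := by
        simpa using norm_add_le (f (γ t) - f (γ s) - fderiv ℝ f (γ s) (γ t - γ s))
          (fderiv ℝ f (γ s) (γ t - γ s))
    _ ≤ ε * ‖γ t - γ s‖ + ‖fderiv ℝ f (γ s)‖ * ‖γ t - γ s‖ := by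
        gcongr
        exact ContinuousLinearMap.le_opNorm _ _
    _ = (‖fderiv ℝ f (γ s)‖ + ε) * ‖t - s‖ := by rw [hn]; ring

open Classical in
/-- The norm `‖f'(x)‖`, with the value `∞` where `f` is not differentiable, so that a path on which
it is integrable spends no length at such points. -/
noncomputable def derivNorm {E F : Type*} [NormedAddCommGroup E] [NormedSpace ℝ E]
    [NormedAddCommGroup F] [NormedSpace ℝ F] (f : E → F) (x : E) : ℝ≥0∞ :=
  if DifferentiableAt ℝ f x then ENNReal.ofReal ‖fderiv ℝ f x‖ else ∞

theorem measurable_derivNorm {E F : Type*} [NormedAddCommGroup E] [NormedSpace ℝ E]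
    [MeasurableSpace E] [OpensMeasurableSpace E] [NormedAddCommGroup F] [NormedSpace ℝ F]
    [CompleteSpace F] (f : E → F) : Measurable (derivNorm f) := by
  unfold derivNorm
  exact Measurable.ite (measurableSet_of_differentiableAt ℝ f)
    (ENNReal.measurable_ofReal.comp
      (continuous_norm.measurable.comp (measurable_fderiv ℝ f))) measurable_const

/-- Upper gradient inequality along a unit speed path that is not exceptional for `f`: only the
points with image in `T` count, if `w` is locally constant off `T`. -/
theorem ofReal_abs_sub_le_lintegral_derivNorm {E F : Type*} [NormedAddCommGroup E]
    [NormedSpace ℝ E] [NormedAddCommGroup F] [NormedSpace ℝ F]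
    {f : E → F} {w : F → ℝ} {γ : IntervalPath E} {L : ℝ} {T : Set F}
    (hw : LipschitzWith 1 w) (hL : 0 ≤ L) (hdom : γ.dom = Icc 0 L) (hγ : Isometry γ.toFun)
    (hfc : ∀ t ∈ Icc 0 L, ContinuousAt f (γ.toFun t))
    (hwT : ∀ t ∈ Icc 0 L, f (γ.toFun t) ∉ T → ∀ᶠ y in 𝓝 (f (γ.toFun t)),
      w y = w (f (γ.toFun t)))
    (hrect : γ.ImageLocRect f) (hN : LuzinNOn (γ.lenTransfer f) γ.lenDom) :
    ENNReal.ofReal |w (f (γ.toFun L)) - w (f (γ.toFun 0))| ≤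
      ∫⁻ t in Icc 0 L, (f ⁻¹' T).indicator (derivNorm f) (γ.toFun t) := by
  have hloc := IntervalPath.locRect_of_isometry hγ
  have hγc := hγ.continuous
  refine ofReal_abs_sub_le_lintegral_of_luzinNOn (v := fun t => w (f (γ.toFun t))) hL
    (fun t ht => ?_) ?_ ?_ (.of_forall fun s hs hd => ?_)
  · exact (hw.continuous.continuousAt.comp
      (ContinuousAt.comp (hfc t ht) hγc.continuousAt)).continuousWithinAt
  · rw [← hdom]
    exact hw.comp_locallyBoundedVariationOn hrect
  · intro A hA hA0
    set V : ℝ → ℝ := fun t => variationOnFromTo (f ∘ γ.toFun) γ.dom γ.base t with hV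
    rw [← hdom] at hA
    refine volume_image_eq_zero_of_dist_le (V := V) (fun s hs t ht => ?_) ?_
    · refine (hw.dist_le_mul _ _).trans ?_
      have hsd := hA hs
      have htd := hA ht
      have key : ∀ s ∈ γ.dom, ∀ t ∈ γ.dom, s ≤ t →
          dist (f (γ.toFun s)) (f (γ.toFun t)) ≤ dist (V s) (V t) := by
        intro s hs t ht hst
        rw [dist_comm (V s), Real.dist_eq]
        refine le_trans ?_ (le_abs_self _)
        have h3 : V t - V s = variationOnFromTo (f ∘ γ.toFun) γ.dom s t := by
          have := variationOnFromTo.add hrect γ.base_mem hs ht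
          simp only [hV]; linarith
        rw [h3, variationOnFromTo.eq_of_le _ _ hst, dist_edist]
        refine ENNReal.toReal_mono (hrect s t hs ht) ?_
        exact eVariationOn.edist_le (f ∘ γ.toFun) ⟨hs, le_rfl, hst⟩ ⟨ht, hst, le_rfl⟩
      rw [NNReal.coe_one, one_mul]
      rcases le_total s t with h | h
      · exact key s hsd t htd h
      · rw [dist_comm, dist_comm (V s)]; exact key t htd s hsd h
    · have h1 : V '' A = γ.lenTransfer f '' (γ.len '' A) := by
        rw [image_image]
        exact image_congr fun t ht => (IntervalPath.lenTransfer_len γ f hloc hrect (hA ht)).symm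
      rw [h1]
      refine hN _ (image_mono hA) ?_
      have h2 : γ.len '' A = (fun t => t - γ.base) '' A :=
        image_congr fun t ht => IntervalPath.len_of_isometry hγ (hA ht)
      rw [h2]
      simpa [sub_eq_add_neg] using hA0
  · have hsI := Ioo_subset_Icc_self hs
    by_cases hT : f (γ.toFun s) ∈ T
    · rw [indicator_of_mem (by exact hT), derivNorm]
      split_ifs with hd'
      · exact ENNReal.ofReal_le_ofReal (abs_deriv_comp_le_norm_fderiv hw hγ hd' hd)
      · exact le_top
    · have hev : (fun t => w (f (γ.toFun t))) =ᶠ[𝓝 s] fun _ => w (f (γ.toFun s)) :=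
        (ContinuousAt.comp (f := γ.toFun) (hfc s hsI) hγc.continuousAt).eventually (hwT s hsI hT)
      simp [hev.deriv_eq]

/-- The segment from `a` to `b`, traversed at unit speed. -/
noncomputable def unitSegment {E : Type*} [NormedAddCommGroup E] [NormedSpace ℝ E] (a b : E)
    (hab : a ≠ b) : IntervalPath E where
  dom := Icc 0 ‖b - a‖
  toFun t := a + t • (‖b - a‖⁻¹ • (b - a))
  ordConnected := ordConnected_Icc
  nontrivial := ⟨0, by simp, ‖b - a‖, by simp, by
    simpa [eq_comm, sub_eq_zero] using hab⟩
  continuousOn := by fun_prop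

theorem isometry_unitSegment {E : Type*} [NormedAddCommGroup E] [NormedSpace ℝ E] {a b : E}
    (hab : a ≠ b) : Isometry (unitSegment a b hab).toFun := by
  have h0 : ‖b - a‖ ≠ 0 := by simpa [sub_eq_zero] using hab.symm
  refine Isometry.of_dist_eq fun s t => ?_
  simp only [unitSegment, dist_add_left]
  rw [dist_eq_norm, ← sub_smul, norm_smul, norm_smul, norm_inv, norm_norm, inv_mul_cancel₀ h0,
    mul_one, Real.dist_eq, Real.norm_eq_abs]

theorem unitSegment_mul {E : Type*} [NormedAddCommGroup E] [NormedSpace ℝ E] {a b : E}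
    (hab : a ≠ b) (s : ℝ) :
    (unitSegment a b hab).toFun (‖b - a‖ * s) = a + s • (b - a) := by
  have h0 : ‖b - a‖ ≠ 0 := by simpa [sub_eq_zero] using hab.symm
  simp only [unitSegment, smul_smul]
  congr 2
  field_simp

/-- Upper gradient inequality along segments: for a weight `h` that detects the exceptional paths
of `f`, the function `‖f'‖ + h` is an upper gradient. -/
theorem ofReal_abs_sub_le_of_lOne {E F : Type*} [NormedAddCommGroup E]
    [NormedSpace ℝ E] [MeasurableSpace E] [BorelSpace E]
    [NormedAddCommGroup F] [NormedSpace ℝ F] [CompleteSpace F]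
    {f : E → F} {w : F → ℝ} {T : Set F} {G : Set E} (hG : IsOpen G) (hf : ContinuousOn f G)
    {g h : E → ℝ≥0∞}
    (hgf : ∀ x ∈ G, f x ∈ T → derivNorm f x ≤ g x)
    (hhex : ∀ γ : IntervalPath E, γ.LiesIn G → γ.LocRect →
      ¬ (γ.LocRect ∧ γ.ImageLocRect f ∧ LuzinNOn (γ.lenTransfer f) γ.lenDom) →
      γ.lineIntegral h = ∞)
    (hw : LipschitzWith 1 w) {a b : E} (hab : segment ℝ a b ⊆ G)
    (hwT : ∀ x ∈ segment ℝ a b, f x ∉ T → ∀ᶠ y in 𝓝 (f x), w y = w (f x)) :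
    ENNReal.ofReal |w (f b) - w (f a)| ≤
      ENNReal.ofReal ‖b - a‖ * ∫⁻ s in Icc (0 : ℝ) 1, (g + h) (a + s • (b - a)) := by
  by_cases hne : a = b
  · simp [hne]
  set γ := unitSegment a b hne with hγd
  have hiso : Isometry γ.toFun := isometry_unitSegment hne
  have hL : 0 < ‖b - a‖ := by simpa [sub_eq_zero] using Ne.symm hne
  have hdom : γ.dom = Icc 0 ‖b - a‖ := rfl
  have hseg : ∀ t ∈ Icc 0 ‖b - a‖, γ.toFun t ∈ segment ℝ a b := by
    intro t ht
    rw [segment_eq_image']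
    refine ⟨t / ‖b - a‖, ⟨div_nonneg ht.1 hL.le, (div_le_one hL).2 ht.2⟩, ?_⟩
    dsimp only
    rw [← unitSegment_mul hne, mul_div_cancel₀ _ hL.ne']
  have hlies : γ.LiesIn G := fun t ht => hab (hseg t ht)
  have hscale : ∫⁻ t in Icc 0 ‖b - a‖, (g + h) (γ.toFun t) =
      ENNReal.ofReal ‖b - a‖ * ∫⁻ s in Icc (0 : ℝ) 1, (g + h) (a + s • (b - a)) := by
    have himg : (fun s : ℝ => ‖b - a‖ * s) '' Icc 0 1 = Icc 0 ‖b - a‖ := by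
      rw [image_mul_left_Icc hL.le zero_le_one]; simp
    rw [← himg, lintegral_image_eq_lintegral_abs_deriv_mul measurableSet_Icc
      (f' := fun _ => ‖b - a‖)
      (fun s _ => by simpa using ((hasDerivAt_id s).const_mul ‖b - a‖).hasDerivWithinAt)
      (mul_right_injective₀ hL.ne').injOn, ← lintegral_const_mul']
    · simp only [abs_norm, hγd, unitSegment_mul]
    · exact ENNReal.ofReal_ne_top
  rw [← hscale]
  by_cases hex : γ.LocRect ∧ γ.ImageLocRect f ∧ LuzinNOn (γ.lenTransfer f) γ.lenDom
  · have h1 := ofReal_abs_sub_le_lintegral_derivNorm (T := T) hw hL.le hdom hiso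
      (fun t ht => hf.continuousAt (hG.mem_nhds (hlies ht)))
      (fun t ht => hwT _ (hseg t ht)) hex.2.1 hex.2.2
    have e0 : γ.toFun 0 = a := by simp [hγd, unitSegment]
    have e1 : γ.toFun ‖b - a‖ = b := by simpa using unitSegment_mul hne 1
    rw [e0, e1] at h1
    refine h1.trans (setLIntegral_mono' measurableSet_Icc fun t ht => ?_)
    refine le_trans ?_ (le_self_add : g _ ≤ g _ + h _)
    by_cases hT : γ.toFun t ∈ f ⁻¹' T
    · rw [indicator_of_mem hT]; exact hgf _ (hlies ht) hT
    · rw [indicator_of_notMem hT]; exact zero_le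
  · have h2 := hhex γ hlies (IntervalPath.locRect_of_isometry hiso) hex
    rw [IntervalPath.lineIntegral_of_isometry hiso, hdom] at h2
    refine le_top.trans (h2.symm.le.trans (lintegral_mono fun t => ?_))
    exact (le_add_self : h _ ≤ g _ + h _)

/-! ### Change of variables -/

/-- Countable superadditivity of the lower integral; the functions need not be measurable. -/
theorem tsum_lintegral_le_lintegral_tsum {α : Type*} [MeasurableSpace α] {μ : Measure α}
    (g : ℕ → α → ℝ≥0∞) : ∑' k, ∫⁻ x, g k x ∂μ ≤ ∫⁻ x, ∑' k, g k x ∂μ := by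
  have hfin : ∀ s : Finset ℕ, ∑ k ∈ s, ∫⁻ x, g k x ∂μ ≤ ∫⁻ x, ∑ k ∈ s, g k x ∂μ := by
    intro s
    induction s using Finset.induction_on with
    | empty => simp
    | insert a s ha ih =>
      simp only [Finset.sum_insert ha]
      exact (add_le_add le_rfl ih).trans (le_lintegral_add _ _)
  rw [ENNReal.tsum_eq_iSup_sum]
  exact iSup_le fun s => (hfin s).trans (lintegral_mono fun x => ENNReal.sum_le_tsum s)

section

variable {E : Type*} [NormedAddCommGroup E] [NormedSpace ℝ E] [FiniteDimensional ℝ E]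

theorem exists_ne_zero_injOn_of_approximatesLinearOn (f : E → E) (A : E →L[ℝ] E) :
    ∃ r : ℝ≥0, r ≠ 0 ∧
      (A.det ≠ 0 → ∀ s, ApproximatesLinearOn f A s r → InjOn f s) := by
  by_cases hA : A.det ≠ 0
  · rcases subsingleton_or_nontrivial E with hE | hE
    · exact ⟨1, one_ne_zero, fun _ s _ =>
        Set.injOn_of_injective (Function.injective_of_subsingleton f)⟩
    · set B := A.toContinuousLinearEquivOfDetNeZero hA with hB
      have hAB : A = (B : E →L[ℝ] E) := by ext; simp [hB]
      have h0 : 0 < ‖(B.symm : E →L[ℝ] E)‖₊⁻¹ := inv_pos.2 B.nnnorm_symm_pos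
      refine ⟨‖(B.symm : E →L[ℝ] E)‖₊⁻¹ / 2, (half_pos h0).ne', fun _ s hs => ?_⟩
      rw [hAB] at hs
      exact hs.injOn (Or.inr (half_lt_self h0))
  · exact ⟨1, one_ne_zero, fun h => absurd h hA⟩

variable [MeasurableSpace E] [BorelSpace E] (μ : Measure E) [μ.IsAddHaarMeasure]

/-- Change of variables with multiplicity, for a map that need not be injective. -/
theorem lintegral_abs_det_mul_le_lintegral_tsum_fiber {f : E → E} {A : Set E}
    (hA : MeasurableSet A) (hd : ∀ x ∈ A, DifferentiableAt ℝ f x)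
    (hdet : ∀ x ∈ A, (fderiv ℝ f x).det ≠ 0) (φ : E → ℝ≥0∞) :
    ∫⁻ x in A, ENNReal.ofReal |(fderiv ℝ f x).det| * φ x ∂μ ≤
      ∫⁻ y, ∑' x : ↥(A ∩ f ⁻¹' {y}), φ x ∂μ := by
  rcases A.eq_empty_or_nonempty with rfl | hne
  · simp
  have hfd : ∀ x ∈ A, HasFDerivWithinAt f (fderiv ℝ f x) A x := fun x hx =>
    (hd x hx).hasFDerivAt.hasFDerivWithinAt
  choose r hr0 hr using exists_ne_zero_injOn_of_approximatesLinearOn f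
  obtain ⟨t, L, htd, htm, htc, htL, hL⟩ :=
    exists_partition_approximatesLinearOn_of_hasFDerivWithinAt f A _ hfd r hr0
  have hinj : ∀ k, InjOn f (A ∩ t k) := fun k => by
    obtain ⟨y, hy, hyL⟩ := hL hne k
    exact hr _ (hyL ▸ hdet y hy) _ (htL k)
  have hunion : A = ⋃ k, A ∩ t k := by rw [← inter_iUnion, inter_eq_left.2 htc]
  have hm : ∀ k, MeasurableSet (A ∩ t k) := fun k => hA.inter (htm k)
  have hdisj : Pairwise (Function.onFun Disjoint fun k => A ∩ t k) := fun i j hij =>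
    (htd hij).mono inter_subset_right inter_subset_right
  set σ : ℕ → E → E := fun k => Function.invFunOn f (A ∩ t k) with hσ
  have himg : ∀ k, MeasurableSet (f '' (A ∩ t k)) := fun k =>
    measurable_image_of_fderivWithin (hm k)
      (fun x hx => (hfd x hx.1).mono inter_subset_left) (hinj k)
  have hpiece : ∀ k, ∫⁻ x in A ∩ t k, ENNReal.ofReal |(fderiv ℝ f x).det| * φ x ∂μ =
      ∫⁻ y, (f '' (A ∩ t k)).indicator (fun y => φ (σ k y)) y ∂μ := by
    intro k
    rw [lintegral_indicator (himg k), lintegral_image_eq_lintegral_abs_det_fderiv_mul μ (hm k)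
      (fun x hx => (hfd x hx.1).mono inter_subset_left) (hinj k)]
    refine setLIntegral_congr_fun (hm k) fun x hx => ?_
    simp only [hσ, (hinj k).leftInvOn_invFunOn hx]
  calc ∫⁻ x in A, ENNReal.ofReal |(fderiv ℝ f x).det| * φ x ∂μ
      = ∑' k, ∫⁻ x in A ∩ t k, ENNReal.ofReal |(fderiv ℝ f x).det| * φ x ∂μ := by
        conv_lhs => rw [hunion]
        exact lintegral_iUnion hm hdisj _
    _ ≤ ∫⁻ y, ∑' k, (f '' (A ∩ t k)).indicator (fun y => φ (σ k y)) y ∂μ := by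
        simp_rw [hpiece]
        exact tsum_lintegral_le_lintegral_tsum _
    _ ≤ _ := by
        refine lintegral_mono fun y => ?_
        set K : Set ℕ := {k | y ∈ f '' (A ∩ t k)} with hK
        have h1 : ∀ k, (f '' (A ∩ t k)).indicator (fun y => φ (σ k y)) y =
            K.indicator (fun k => φ (σ k y)) k := fun k => by
          by_cases h : y ∈ f '' (A ∩ t k)
          · rw [indicator_of_mem h, indicator_of_mem (by exact h)]
          · rw [indicator_of_notMem h, indicator_of_notMem (by exact h)]
        dsimp only
        simp_rw [h1]
        rw [← tsum_subtype K fun k => φ (σ k y)]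
        have hmem : ∀ k : K, σ k y ∈ A ∩ t k := fun k => Function.invFunOn_mem k.2
        let ψ : K → ↥(A ∩ f ⁻¹' {y}) := fun k =>
          ⟨σ k y, (hmem k).1, Function.invFunOn_eq k.2⟩
        have hψ : Function.Injective ψ := by
          intro i j hij
          have hij' : σ i y = σ j y := congrArg Subtype.val hij
          by_contra hne'
          have hne'' : (i : ℕ) ≠ j := fun h => hne' (Subtype.ext h)
          exact disjoint_left.1 (htd hne'') (hmem i).2 (hij' ▸ (hmem j).2)
        exact ENNReal.tsum_comp_le_tsum_of_injective hψ fun x => φ x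

/-- `|det A| ≤ ‖A‖ⁿ`, because `A` maps the unit ball into the ball of radius `‖A‖`. -/
theorem abs_det_le_norm_pow (A : E →L[ℝ] E) : |A.det| ≤ ‖A‖ ^ Module.finrank ℝ E := by
  set μ : Measure E := Measure.addHaar
  have h1 : A '' Metric.closedBall 0 1 ⊆ Metric.closedBall 0 ‖A‖ := by
    rintro _ ⟨x, hx, rfl⟩
    rw [mem_closedBall_zero_iff] at hx ⊢
    exact (A.le_opNorm x).trans (mul_le_of_le_one_right (norm_nonneg _) hx)
  have h2 := measure_mono (μ := μ) h1
  rw [Measure.addHaar_image_continuousLinearMap,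
    Measure.addHaar_closedBall' μ 0 (norm_nonneg _)] at h2
  have hpos : μ (Metric.closedBall (0 : E) 1) ≠ 0 :=
    (Metric.measure_closedBall_pos μ _ one_pos).ne'
  have hfin : μ (Metric.closedBall (0 : E) 1) ≠ ∞ := measure_closedBall_lt_top.ne
  rw [ENNReal.mul_le_mul_iff_left hpos hfin] at h2
  exact (ENNReal.ofReal_le_ofReal_iff (by positivity)).1 h2

end

section Euclidean

variable {n : ℕ}

local notation "𝔼" => EuclideanSpace ℝ (Fin n)

/-- The set where `f` is differentiable with zero Jacobian has null image by Sard's theorem, hence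
is null by the `N⁻¹`-property. -/
theorem ae_det_fderiv_ne_zero {f : 𝔼 → 𝔼} {G : Set 𝔼} (hN : LuzinNInvOn f G) :
    ∀ᵐ x, x ∈ G → DifferentiableAt ℝ f x → (fderiv ℝ f x).det ≠ 0 := by
  set Z : Set 𝔼 := {x | DifferentiableAt ℝ f x ∧ (fderiv ℝ f x).det = 0}
  have h0 : volume (f '' Z) = 0 :=
    addHaar_image_eq_zero_of_det_fderivWithin_eq_zero volume
      (fun x hx => hx.1.hasFDerivAt.hasFDerivWithinAt) fun x hx => hx.2
  have h1 := hN _ h0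
  rw [ae_iff]
  refine measure_mono_null (fun x hx => ?_) h1
  simp only [mem_ofPred_eq, Classical.not_imp, not_not] at hx
  exact ⟨hx.1, x, hx.2, rfl⟩

/-- The substitution `∫_A ‖f'‖ᵖ = ∫_A K_O |J| ≤ ∫ K_I`. -/
theorem lintegral_derivNorm_rpow_le_lintegral_innerDil {p : ℝ} {f : 𝔼 → 𝔼} {G A : Set 𝔼} {T : Set 𝔼}
    (hd : ∀ᵐ x, x ∈ G → DifferentiableAt ℝ f x) (hN : LuzinNInvOn f G)
    (hA : MeasurableSet A) (hAG : A ⊆ G) (hT : MeasurableSet T) (hAT : MapsTo f A T) (hp : 0 ≤ p) :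
    ∫⁻ x in A, derivNorm f x ^ p ≤ ∫⁻ y in T, innerDil p f A y := by
  set R : Set 𝔼 := {x | DifferentiableAt ℝ f x} ∩ {x | (fderiv ℝ f x).det ≠ 0} with hR
  have hRm : MeasurableSet R := by
    refine (measurableSet_of_differentiableAt ℝ f).inter ?_
    exact (measurableSet_singleton (0 : ℝ)).compl.preimage
      (ContinuousLinearMap.continuous_det.measurable.comp (measurable_fderiv ℝ f))
  have hae : ∀ᵐ x, x ∈ A ↔ x ∈ A ∩ R := by
    filter_upwards [hd, ae_det_fderiv_ne_zero hN] with x h1 h2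
    exact ⟨fun hx => ⟨hx, h1 (hAG hx), h2 (hAG hx) (h1 (hAG hx))⟩, fun hx => hx.1⟩
  calc ∫⁻ x in A, derivNorm f x ^ p = ∫⁻ x in A ∩ R, derivNorm f x ^ p :=
        setLIntegral_congr (eventuallyEq_set.2 hae)
    _ = ∫⁻ x in A ∩ R, ENNReal.ofReal |(fderiv ℝ f x).det| * outerDil p f x := by
        refine setLIntegral_congr_fun (hA.inter hRm) fun x hx => ?_
        have h1 : DifferentiableAt ℝ f x := hx.2.1
        have h2 : (fderiv ℝ f x).det ≠ 0 := hx.2.2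
        simp only [derivNorm, outerDil, if_pos h1, if_pos h2]
        rw [← ENNReal.ofReal_mul (abs_nonneg _), mul_div_cancel₀ _ (abs_ne_zero.2 h2),
          ENNReal.ofReal_rpow_of_nonneg (norm_nonneg _) hp]
    _ ≤ ∫⁻ y, ∑' x : ↥((A ∩ R) ∩ f ⁻¹' {y}), outerDil p f x :=
        lintegral_abs_det_mul_le_lintegral_tsum_fiber volume (hA.inter hRm) (fun x hx => hx.2.1)
          (fun x hx => hx.2.2) _
    _ ≤ ∫⁻ y, T.indicator (innerDil p f A) y := by
        refine lintegral_mono fun y => ?_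
        by_cases hy : y ∈ T
        · rw [indicator_of_mem hy]
          exact ENNReal.tsum_mono_subtype _ (inter_subset_inter_left _ inter_subset_left)
        · have : IsEmpty ↥((A ∩ R) ∩ f ⁻¹' {y}) :=
            ⟨fun x => hy (by have := hAT x.2.1.1; rwa [show f x = y from x.2.2] at this)⟩
          simp
    _ = ∫⁻ y in T, innerDil p f A y := lintegral_indicator hT _

theorem innerDil_mono (p : ℝ) (f : 𝔼 → 𝔼) {S S' : Set 𝔼} (h : S ⊆ S') (y : 𝔼) :
    innerDil p f S y ≤ innerDil p f S' y :=
  ENNReal.tsum_mono_subtype _ (inter_subset_inter_left _ h)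

/-- A map with the `N`-property does not enlarge volume by more than `∫ |J| ≤ ∫ (1 + ‖f'‖ᵖ)`. -/
theorem volume_image_le_lintegral_one_add_derivNorm_rpow {p : ℝ} (hp : (n : ℝ) ≤ p) {f : 𝔼 → 𝔼}
    {G A : Set 𝔼} (hd : ∀ᵐ x, x ∈ G → DifferentiableAt ℝ f x) (hN : LuzinNOn f G)
    (hA : MeasurableSet A) (hAG : A ⊆ G) :
    volume (f '' A) ≤ ∫⁻ x in A, (1 + derivNorm f x ^ p) := by
  set R : Set 𝔼 := {x | DifferentiableAt ℝ f x} with hR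
  have hRm : MeasurableSet R := measurableSet_of_differentiableAt ℝ f
  have hnull : volume (A \ R) = 0 := by
    rw [ae_iff] at hd
    refine measure_mono_null (fun x hx => ?_) hd
    simp only [mem_ofPred_eq, Classical.not_imp]
    exact ⟨hAG hx.1, hx.2⟩
  have hsub : f '' A ⊆ f '' (A ∩ R) ∪ f '' (A \ R) := by
    rw [← image_union, inter_union_sdiff]
  calc volume (f '' A) ≤ volume (f '' (A ∩ R)) + volume (f '' (A \ R)) :=
        (measure_mono hsub).trans (measure_union_le _ _)
    _ = volume (f '' (A ∩ R)) := by
        rw [hN _ (sdiff_subset.trans hAG) hnull, add_zero]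
    _ ≤ ∫⁻ x in A ∩ R, ENNReal.ofReal |(fderiv ℝ f x).det| :=
        addHaar_image_le_lintegral_abs_det_fderiv volume (hA.inter hRm)
          fun x hx => (DifferentiableAt.hasFDerivAt hx.2).hasFDerivWithinAt
    _ ≤ ∫⁻ x in A ∩ R, (1 + derivNorm f x ^ p) := by
        refine setLIntegral_mono' (hA.inter hRm) fun x hx => ?_
        have h1 : DifferentiableAt ℝ f x := hx.2
        have hp0 : 0 ≤ p := (Nat.cast_nonneg n).trans hp
        rw [derivNorm, if_pos h1, ENNReal.ofReal_rpow_of_nonneg (norm_nonneg _) hp0,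
          ← ENNReal.ofReal_one, ← ENNReal.ofReal_add zero_le_one (by positivity)]
        refine ENNReal.ofReal_le_ofReal ((abs_det_le_norm_pow _).trans ?_)
        rw [finrank_euclideanSpace_fin]
        rcases le_total ‖fderiv ℝ f x‖ 1 with h | h
        · exact (pow_le_one₀ (norm_nonneg _) h).trans (le_add_of_nonneg_right (by positivity))
        · rw [← Real.rpow_natCast]
          exact (Real.rpow_le_rpow_of_exponent_le h hp).trans (le_add_of_nonneg_left zero_le_one)
    _ ≤ _ := lintegral_mono_set inter_subset_left

end Euclidean

/-! ### Morrey's estimate on convex sets -/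

section Morrey

variable {W : Type*} [NormedAddCommGroup W] [NormedSpace ℝ W] [FiniteDimensional ℝ W]
  [MeasurableSpace W] [BorelSpace W] (μ : Measure W) [μ.IsAddHaarMeasure]

theorem ofReal_pow_mul_lintegral_comp_homothety_le {Q : Set W} (hQ : Convex ℝ Q)
    (hQm : MeasurableSet Q) {a : W} (ha : a ∈ Q) {s : ℝ} (hs : s ∈ Ioc 0 1) (F : W → ℝ≥0∞) :
    ENNReal.ofReal (s ^ Module.finrank ℝ W) * ∫⁻ z in Q, F (a + s • (z - a)) ∂μ ≤
      ∫⁻ z in Q, F z ∂μ := by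
  have himg : (fun z => a + s • (z - a)) '' Q ⊆ Q := by
    rintro _ ⟨z, hz, rfl⟩
    exact hQ.add_smul_sub_mem ha hz ⟨hs.1.le, hs.2⟩
  have hder : ∀ z ∈ Q, HasFDerivWithinAt (fun z => a + s • (z - a))
      (s • ContinuousLinearMap.id ℝ W) Q z := fun z _ =>
    ((((hasFDerivAt_id z).sub_const a).const_smul s).const_add a).hasFDerivWithinAt
  have hinj : InjOn (fun z => a + s • (z - a)) Q := by
    intro z _ z' _ h
    simpa using smul_right_injective W hs.1.ne' (add_left_cancel h)
  have hdet : (s • ContinuousLinearMap.id ℝ W).det = s ^ Module.finrank ℝ W := by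
    simp [ContinuousLinearMap.det]
  have := lintegral_image_eq_lintegral_abs_det_fderiv_mul μ hQm hder hinj F
  rw [hdet, lintegral_const_mul' _ _ ENNReal.ofReal_ne_top,
    abs_of_pos (pow_pos hs.1 _)] at this
  rw [← this]
  exact lintegral_mono_set himg

/-- The constant `∫₀¹ s^{-d/(d+1)} ds` in Morrey's estimate; it is finite because `d/(d+1) < 1`. -/
noncomputable def morreyConst (d : ℕ) : ℝ≥0∞ :=
  ∫⁻ s in Icc (0 : ℝ) 1, ENNReal.ofReal (s ^ (-(d / (d + 1) : ℝ)))

theorem morreyConst_ne_top (d : ℕ) : morreyConst d ≠ ∞ := by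
  have h1 : (-1 : ℝ) < -(d / (d + 1) : ℝ) := by
    rw [neg_lt_neg_iff, div_lt_one (by positivity)]
    linarith
  have h2 := intervalIntegral.intervalIntegrable_rpow' (a := 0) (b := 1) h1
  rw [intervalIntegrable_iff_integrableOn_Icc_of_le zero_le_one] at h2
  exact (Integrable.lintegral_lt_top h2).ne

/-- The elementary Young inequality that replaces Hölder's. -/
theorem le_add_pow_succ_mul_inv_pow (x : ℝ≥0∞) {l : ℝ≥0∞} (h0 : l ≠ 0) (ht : l ≠ ∞) (d : ℕ) :
    x ≤ l + (l ^ d)⁻¹ * x ^ (d + 1) := by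
  rcases le_total x l with h | h
  · exact h.trans le_self_add
  · refine le_trans ?_ le_add_self
    calc x = (l ^ d)⁻¹ * l ^ d * x := by
          rw [ENNReal.inv_mul_cancel (pow_ne_zero _ h0) (ENNReal.pow_ne_top ht), one_mul]
      _ ≤ (l ^ d)⁻¹ * x ^ d * x := by gcongr
      _ = (l ^ d)⁻¹ * x ^ (d + 1) := by rw [pow_succ, mul_assoc]

/-- Contraction towards `a` by the factor `s`, with the parameter of Young's inequality chosen as
`ε s^{-d/(d+1)}` to balance the two terms. -/
theorem lintegral_comp_homothety_le {Q : Set W} (hQ : Convex ℝ Q) (hQm : MeasurableSet Q)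
    {d : ℕ} (hd : Module.finrank ℝ W = d) {a : W} (ha : a ∈ Q) {s : ℝ} (hs : s ∈ Ioc 0 1)
    {G : W → ℝ≥0∞} (hG : Measurable G) {ε : ℝ} (hε : 0 < ε) :
    ∫⁻ z in Q, G (a + s • (z - a)) ∂μ ≤ ENNReal.ofReal (s ^ (-(d / (d + 1) : ℝ))) *
      (ENNReal.ofReal ε * μ Q + ENNReal.ofReal (ε ^ d)⁻¹ * ∫⁻ z in Q, G z ^ (d + 1) ∂μ) := by
  set k : ℝ := s ^ (-(d / (d + 1) : ℝ)) with hk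
  have hk0 : 0 < k := Real.rpow_pos_of_pos hs.1 _
  have hsd : 0 < s ^ d := pow_pos hs.1 d
  have hkd : ((ε * k) ^ d)⁻¹ = k * (ε ^ d)⁻¹ * s ^ d := by
    have h1 : k ^ d * k * s ^ d = 1 := by
      rw [← pow_succ, hk, ← Real.rpow_natCast, ← Real.rpow_mul hs.1.le, ← Real.rpow_natCast s d,
        ← Real.rpow_add hs.1]
      have : (-(d / (d + 1) : ℝ)) * ((d + 1 : ℕ) : ℝ) + d = 0 := by
        push_cast
        field_simp
        ring
      rw [this, Real.rpow_zero]
    rw [mul_pow, mul_inv]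
    field_simp
    linarith
  have hI := ofReal_pow_mul_lintegral_comp_homothety_le μ hQ hQm ha hs fun z => G z ^ (d + 1)
  rw [hd] at hI
  have hGm : Measurable fun z => G (a + s • (z - a)) := hG.comp (by fun_prop)
  calc ∫⁻ z in Q, G (a + s • (z - a)) ∂μ
      ≤ ∫⁻ z in Q, (ENNReal.ofReal (ε * k) +
          (ENNReal.ofReal (ε * k) ^ d)⁻¹ * G (a + s • (z - a)) ^ (d + 1)) ∂μ :=
        lintegral_mono fun z => le_add_pow_succ_mul_inv_pow _
          (by simpa using mul_pos hε hk0) ENNReal.ofReal_ne_top d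
    _ = ENNReal.ofReal (ε * k) * μ Q + ENNReal.ofReal (k * (ε ^ d)⁻¹) *
          (ENNReal.ofReal (s ^ d) * ∫⁻ z in Q, G (a + s • (z - a)) ^ (d + 1) ∂μ) := by
        rw [lintegral_add_left measurable_const, setLIntegral_const,
          lintegral_const_mul _ (hGm.pow_const _), ← mul_assoc,
          ← ENNReal.ofReal_mul (by positivity),
          ← hkd, ← ENNReal.ofReal_pow (by positivity), ENNReal.ofReal_inv_of_pos (by positivity)]
    _ ≤ ENNReal.ofReal (ε * k) * μ Q + ENNReal.ofReal (k * (ε ^ d)⁻¹) *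
          ∫⁻ z in Q, G z ^ (d + 1) ∂μ := by gcongr
    _ = _ := by
        rw [mul_comm ε k, ENNReal.ofReal_mul hk0.le, ENNReal.ofReal_mul hk0.le]
        ring

/-- Morrey's oscillation estimate in dimension `d` with exponent `d + 1`: average the upper
gradient inequality over all broken lines from `a` via `z ∈ Q` to `b`. -/
theorem ofReal_abs_sub_mul_measure_le {Q : Set W} (hQ : Convex ℝ Q) (hQm : MeasurableSet Q)
    {d : ℕ} (hd : Module.finrank ℝ W = d) {G : W → ℝ≥0∞} (hG : Measurable G) {v : W → ℝ}
    {K : ℝ≥0∞} (hK : K ≠ ∞)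
    (hv : ∀ a ∈ Q, ∀ b ∈ Q,
      ENNReal.ofReal |v b - v a| ≤ K * ∫⁻ s in Icc (0 : ℝ) 1, G (a + s • (b - a)))
    {a b : W} (ha : a ∈ Q) (hb : b ∈ Q) {ε : ℝ} (hε : 0 < ε) :
    ENNReal.ofReal |v b - v a| * μ Q ≤ 2 * K * morreyConst d *
      (ENNReal.ofReal ε * μ Q + ENNReal.ofReal (ε ^ d)⁻¹ * ∫⁻ z in Q, G z ^ (d + 1) ∂μ) := by
  set B := ENNReal.ofReal ε * μ Q + ENNReal.ofReal (ε ^ d)⁻¹ * ∫⁻ z in Q, G z ^ (d + 1) ∂μ with hB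
  have hm : ∀ c : W, Measurable fun q : W × ℝ => G (c + q.2 • (q.1 - c)) := fun c =>
    hG.comp (by fun_prop)
  have hone : ∀ c ∈ Q, ∫⁻ z in Q, (∫⁻ s in Icc (0 : ℝ) 1, G (c + s • (z - c))) ∂μ ≤
      morreyConst d * B := by
    intro c hc
    rw [lintegral_lintegral_swap (hm c).aemeasurable, morreyConst, ← lintegral_mul_const]
    · refine lintegral_mono_ae ((ae_restrict_iff' measurableSet_Icc).2 ?_)
      have h0 : ∀ᵐ s : ℝ, s ≠ 0 := by simp [ae_iff, measure_singleton]
      filter_upwards [h0] with s hs0 hs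
      exact lintegral_comp_homothety_le μ hQ hQm hd hc ⟨lt_of_le_of_ne hs.1 hs0.symm, hs.2⟩ hG hε
    · fun_prop
  calc ENNReal.ofReal |v b - v a| * μ Q = ∫⁻ _ in Q, ENNReal.ofReal |v b - v a| ∂μ := by
        rw [setLIntegral_const]
    _ ≤ ∫⁻ z in Q, (K * (∫⁻ s in Icc (0 : ℝ) 1, G (a + s • (z - a))) +
          K * ∫⁻ s in Icc (0 : ℝ) 1, G (b + s • (z - b))) ∂μ := by
        refine setLIntegral_mono' hQm fun z hz => ?_
        refine le_trans ?_ (add_le_add (hv a ha z hz) (hv b hb z hz))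
        rw [← ENNReal.ofReal_add (abs_nonneg _) (abs_nonneg _)]
        refine ENNReal.ofReal_le_ofReal ?_
        rw [abs_sub_comm (v z) (v b), add_comm]
        exact abs_sub_le _ _ _
    _ = K * (∫⁻ z in Q, (∫⁻ s in Icc (0 : ℝ) 1, G (a + s • (z - a))) ∂μ) +
          K * ∫⁻ z in Q, (∫⁻ s in Icc (0 : ℝ) 1, G (b + s • (z - b))) ∂μ := by
        rw [lintegral_add_left ((hm a).lintegral_prod_right'.const_mul K),
          lintegral_const_mul' _ _ hK, lintegral_const_mul' _ _ hK]
    _ ≤ K * (morreyConst d * B) + K * (morreyConst d * B) := by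
        gcongr
        · exact hone a ha
        · exact hone b hb
    _ = _ := by ring

end Morrey

/-! ### Oscillation on the boundaries of small cubes -/

/-- The maximum norm on Euclidean space; its spheres are boundaries of cubes. -/
noncomputable def supNorm {n : ℕ} (x : EuclideanSpace ℝ (Fin n)) : ℝ := ‖WithLp.ofLp x‖

theorem continuous_supNorm {n : ℕ} : Continuous (supNorm (n := n)) := by
  unfold supNorm; fun_prop

theorem supNorm_nonneg {n : ℕ} (x : EuclideanSpace ℝ (Fin n)) : 0 ≤ supNorm x := norm_nonneg _

theorem supNorm_eq_zero {n : ℕ} {x : EuclideanSpace ℝ (Fin n)} : supNorm x = 0 ↔ x = 0 := by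
  simp [supNorm]

theorem abs_apply_le_supNorm {n : ℕ} (x : EuclideanSpace ℝ (Fin n)) (i : Fin n) :
    |x i| ≤ supNorm x := norm_le_pi_norm (WithLp.ofLp x) i

theorem norm_le_mul_supNorm {n : ℕ} (x : EuclideanSpace ℝ (Fin n)) : ‖x‖ ≤ n * supNorm x := by
  calc ‖x‖ = ‖∑ i, EuclideanSpace.single i (x i)‖ := by
        congr 1
        ext j
        simp [Finset.sum_apply, Pi.single_apply]
    _ ≤ ∑ i, ‖EuclideanSpace.single i (x i)‖ := norm_sum_le _ _
    _ ≤ ∑ _i : Fin n, supNorm x := by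
        refine Finset.sum_le_sum fun i _ => ?_
        rw [PiLp.norm_single]
        exact abs_apply_le_supNorm x i
    _ = n * supNorm x := by simp

section Faces

variable {d : ℕ}

local notation "𝔼" => EuclideanSpace ℝ (Fin (d + 1))

/-- The point of the hyperplane `{x | (x - x₀)ᵢ = τ}` whose remaining coordinates relative to `x₀`
are `z`. -/
noncomputable def facePoint (x₀ : 𝔼) (i : Fin (d + 1)) (τ : ℝ) (z : Fin d → ℝ) : 𝔼 :=
  x₀ + WithLp.toLp 2 (i.insertNth τ z : Fin (d + 1) → ℝ)

theorem measurePreserving_facePoint (x₀ : 𝔼) (i : Fin (d + 1)) :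
    MeasurePreserving fun q : ℝ × (Fin d → ℝ) => facePoint x₀ i q.1 q.2 := by
  have h1 := (volume_preserving_piFinSuccAbove (fun _ : Fin (d + 1) => ℝ) i).symm
  have h2 := PiLp.volume_preserving_toLp (Fin (d + 1))
  have h3 := measurePreserving_add_left (volume : Measure 𝔼) x₀
  exact h3.comp (h2.comp h1)

theorem lintegral_lintegral_facePoint (x₀ : 𝔼) (i : Fin (d + 1)) {F : 𝔼 → ℝ≥0∞}
    (hF : Measurable F) : ∫⁻ τ, ∫⁻ z, F (facePoint x₀ i τ z) = ∫⁻ x, F x := by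
  have hmp := measurePreserving_facePoint x₀ i
  rw [← hmp.lintegral_comp hF]
  exact (lintegral_prod _ (hF.comp hmp.measurable).aemeasurable).symm

theorem facePoint_sub_apply_self (x₀ : 𝔼) (i : Fin (d + 1)) (τ : ℝ) (z : Fin d → ℝ) :
    (facePoint x₀ i τ z - x₀) i = τ := by
  simp [facePoint]

theorem supNorm_facePoint_sub (x₀ : 𝔼) (i : Fin (d + 1)) (τ : ℝ) {z : Fin d → ℝ}
    (hz : ‖z‖ ≤ |τ|) : supNorm (facePoint x₀ i τ z - x₀) = |τ| := by
  refine le_antisymm ?_ ?_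
  · refine (pi_norm_le_iff_of_nonneg (abs_nonneg τ)).2 (i.forall_iff_succAbove.2 ⟨?_, fun j => ?_⟩)
    · simp [facePoint]
    · simpa [facePoint] using (norm_le_pi_norm z j).trans hz
  · have := abs_apply_le_supNorm (facePoint x₀ i τ z - x₀) i
    rwa [facePoint_sub_apply_self] at this

theorem exists_eq_facePoint {x₀ x : 𝔼} {i : Fin (d + 1)} :
    ∃ z : Fin d → ℝ, ‖z‖ ≤ supNorm (x - x₀) ∧ x = facePoint x₀ i ((x - x₀) i) z := by
  refine ⟨i.removeNth (WithLp.ofLp (x - x₀)), ?_, ?_⟩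
  · exact (pi_norm_le_iff_of_nonneg (supNorm_nonneg _)).2 fun j =>
      abs_apply_le_supNorm (x - x₀) (i.succAbove j)
  · ext j
    have h := congrFun (Fin.insertNth_self_removeNth i (WithLp.ofLp (x - x₀))) j
    simp only [facePoint, PiLp.add_apply]
    rw [show (x - x₀) i = WithLp.ofLp (x - x₀) i from rfl, h]
    simp

theorem facePoint_add_smul_sub (x₀ : 𝔼) (i : Fin (d + 1)) (τ : ℝ) (a b : Fin d → ℝ) (s : ℝ) :
    facePoint x₀ i τ a + s • (facePoint x₀ i τ b - facePoint x₀ i τ a) =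
      facePoint x₀ i τ (a + s • (b - a)) := by
  ext j
  revert j
  refine i.forall_iff_succAbove.2 ⟨?_, fun j => ?_⟩ <;> simp [facePoint]
  ring

/-- `g` is an upper gradient of `u` along the segments contained in `S`. -/
def IsSegmentUpperGradient {E : Type*} [NormedAddCommGroup E] [NormedSpace ℝ E] (g : E → ℝ≥0∞)
    (u : E → ℝ) (S : Set E) : Prop :=
  ∀ a b, segment ℝ a b ⊆ S → ENNReal.ofReal |u b - u a| ≤
    ENNReal.ofReal ‖b - a‖ * ∫⁻ s in Icc (0 : ℝ) 1, g (a + s • (b - a))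

/-- The open cube with centre `x₀` and half side `R`, without its centre. -/
def puncturedCube {n : ℕ} (x₀ : EuclideanSpace ℝ (Fin n)) (R : ℝ) :
    Set (EuclideanSpace ℝ (Fin n)) :=
  {x | 0 < supNorm (x - x₀) ∧ supNorm (x - x₀) < R}

/-- The integral of `g^{d+1}` over the face `{(x - x₀)ᵢ = τ}` of the cube of half side `|τ|`. -/
noncomputable def faceEnergy (x₀ : 𝔼) (g : 𝔼 → ℝ≥0∞) (i : Fin (d + 1)) (τ : ℝ) : ℝ≥0∞ :=
  ∫⁻ z in Metric.closedBall (0 : Fin d → ℝ) |τ|, g (facePoint x₀ i τ z) ^ (d + 1)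

/-- Morrey's estimate on a face of a cube. -/
theorem ofReal_abs_sub_facePoint_le {x₀ : 𝔼} {g : 𝔼 → ℝ≥0∞} (hg : Measurable g) {u : 𝔼 → ℝ}
    {R : ℝ} (hu : IsSegmentUpperGradient g u (puncturedCube x₀ R)) (i : Fin (d + 1)) {τ : ℝ}
    (hτ0 : 0 < |τ|) (hτR : |τ| < R) {a b : Fin d → ℝ} (ha : ‖a‖ ≤ |τ|) (hb : ‖b‖ ≤ |τ|) {ε : ℝ}
    (hε : 0 < ε) :
    ENNReal.ofReal |u (facePoint x₀ i τ b) - u (facePoint x₀ i τ a)| ≤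
      ENNReal.ofReal (4 * (d + 1)) * morreyConst d * (ENNReal.ofReal ε +
        ENNReal.ofReal ((2 * ε) ^ d)⁻¹ * (ENNReal.ofReal |τ| * faceEnergy x₀ g i τ)) := by
  set t := |τ| with ht
  set Q : Set (Fin d → ℝ) := Metric.closedBall 0 t with hQ
  have hQv : volume Q = ENNReal.ofReal ((2 * t) ^ d) := by
    rw [hQ, Real.volume_pi_closedBall _ hτ0.le, Fintype.card_fin]
  have h2t : 0 < (2 * t) ^ d := by positivity
  have hQ0 : volume Q ≠ 0 := by rw [hQv]; simpa using h2t
  have hQt : volume Q ≠ ∞ := by rw [hQv]; exact ENNReal.ofReal_ne_top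
  have hgm : Measurable fun z => g (facePoint x₀ i τ z) :=
    hg.comp ((measurePreserving_facePoint x₀ i).measurable.comp measurable_prodMk_left)
  have hv : ∀ a ∈ Q, ∀ b ∈ Q,
      ENNReal.ofReal |u (facePoint x₀ i τ b) - u (facePoint x₀ i τ a)| ≤
      ENNReal.ofReal (2 * (d + 1) * t) *
        ∫⁻ s in Icc (0 : ℝ) 1, g (facePoint x₀ i τ (a + s • (b - a))) := by
    intro a ha b hb
    have hseg : segment ℝ (facePoint x₀ i τ a) (facePoint x₀ i τ b) ⊆ puncturedCube x₀ R := by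
      rw [segment_eq_image']
      rintro _ ⟨s, hs, rfl⟩
      dsimp only
      rw [facePoint_add_smul_sub]
      have hmem : a + s • (b - a) ∈ Q := (convex_closedBall 0 t).add_smul_sub_mem ha hb hs
      have := supNorm_facePoint_sub x₀ i τ (mem_closedBall_zero_iff.1 hmem)
      rw [puncturedCube, mem_ofPred_eq, this]
      exact ⟨hτ0, hτR⟩
    refine (hu _ _ hseg).trans ?_
    simp_rw [facePoint_add_smul_sub]
    gcongr
    have h1 := supNorm_facePoint_sub x₀ i τ (mem_closedBall_zero_iff.1 ha)
    have h2 := supNorm_facePoint_sub x₀ i τ (mem_closedBall_zero_iff.1 hb)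
    have h3 := norm_le_mul_supNorm (facePoint x₀ i τ a - x₀)
    have h4 := norm_le_mul_supNorm (facePoint x₀ i τ b - x₀)
    rw [h1] at h3
    rw [h2] at h4
    calc ‖facePoint x₀ i τ b - facePoint x₀ i τ a‖
        ≤ ‖facePoint x₀ i τ b - x₀‖ + ‖facePoint x₀ i τ a - x₀‖ := by
          simpa using norm_sub_le (facePoint x₀ i τ b - x₀) (facePoint x₀ i τ a - x₀)
      _ ≤ 2 * (d + 1) * t := by push_cast at h3 h4; linarith
  have hεt : 0 < ε / t := div_pos hε hτ0
  have key := ofReal_abs_sub_mul_measure_le volume (convex_closedBall (0 : Fin d → ℝ) t)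
    Metric.isClosed_closedBall.measurableSet (Module.finrank_fin_fun ℝ) hgm
    (v := fun z => u (facePoint x₀ i τ z)) (ENNReal.ofReal_ne_top) hv
    (mem_closedBall_zero_iff.2 ha) (mem_closedBall_zero_iff.2 hb) hεt
  rw [← hQ] at key
  have e1 : ENNReal.ofReal (2 * (d + 1) * t) * ENNReal.ofReal (ε / t) =
      ENNReal.ofReal (2 * (d + 1)) * ENNReal.ofReal ε := by
    rw [← ENNReal.ofReal_mul (by positivity), ← ENNReal.ofReal_mul (by positivity)]
    congr 1
    field_simp
  have e2 : ENNReal.ofReal (2 * (d + 1) * t) * ENNReal.ofReal ((ε / t) ^ d)⁻¹ =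
      ENNReal.ofReal (2 * (d + 1)) * ENNReal.ofReal ((2 * ε) ^ d)⁻¹ * ENNReal.ofReal t *
        volume Q := by
    rw [hQv, ← ENNReal.ofReal_mul (by positivity), ← ENNReal.ofReal_mul (by positivity),
      ← ENNReal.ofReal_mul (by positivity), ← ENNReal.ofReal_mul (by positivity)]
    congr 1
    rw [div_pow, mul_pow, mul_pow]
    field_simp
  have e3 : ENNReal.ofReal (4 * (d + 1)) = 2 * ENNReal.ofReal (2 * (d + 1)) := by
    rw [← ENNReal.ofReal_ofNat 2, ← ENNReal.ofReal_mul (by positivity)]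
    congr 1
    ring
  rw [← ENNReal.mul_le_mul_iff_left hQ0 hQt]
  refine key.trans_eq ?_
  set I := ∫⁻ z in Q, g (facePoint x₀ i τ z) ^ (d + 1) with hI
  have hfe : faceEnergy x₀ g i τ = I := rfl
  rw [hfe, e3]
  calc 2 * ENNReal.ofReal (2 * (d + 1) * t) * morreyConst d *
        (ENNReal.ofReal (ε / t) * volume Q + ENNReal.ofReal ((ε / t) ^ d)⁻¹ * I)
      = 2 * morreyConst d * ((ENNReal.ofReal (2 * (d + 1) * t) * ENNReal.ofReal (ε / t)) * volume Q
          + (ENNReal.ofReal (2 * (d + 1) * t) * ENNReal.ofReal ((ε / t) ^ d)⁻¹) * I) := by ring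
    _ = _ := by rw [e1, e2]; ring

/-- The total energy of the boundary of the cube of half side `t`. -/
noncomputable def cubeEnergy (x₀ : 𝔼) (g : 𝔼 → ℝ≥0∞) (t : ℝ) : ℝ≥0∞ :=
  ∑ i, (faceEnergy x₀ g i t + faceEnergy x₀ g i (-t))

theorem faceEnergy_le_cubeEnergy (x₀ : 𝔼) (g : 𝔼 → ℝ≥0∞) (i : Fin (d + 1)) (τ : ℝ) :
    faceEnergy x₀ g i τ ≤ cubeEnergy x₀ g |τ| := by
  have h : faceEnergy x₀ g i τ ≤ faceEnergy x₀ g i |τ| + faceEnergy x₀ g i (-|τ|) := by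
    rcases abs_choice τ with h | h <;> rw [h]
    · exact le_self_add
    · rw [neg_neg]; exact le_add_self
  exact h.trans (Finset.single_le_sum (f := fun i =>
    faceEnergy x₀ g i |τ| + faceEnergy x₀ g i (-|τ|)) (fun _ _ => zero_le) (Finset.mem_univ i))

theorem lintegral_cubeEnergy_lt_top (x₀ : 𝔼) {g : 𝔼 → ℝ≥0∞} (hg : Measurable g)
    (hfin : ∫⁻ x, g x ^ (d + 1) < ∞) : ∫⁻ t, cubeEnergy x₀ g t < ∞ := by
  have hle : ∀ i τ, faceEnergy x₀ g i τ ≤ ∫⁻ z, g (facePoint x₀ i τ z) ^ (d + 1) :=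
    fun i τ => setLIntegral_le_lintegral _ _
  have hm : ∀ i, Measurable fun τ : ℝ => ∫⁻ z, g (facePoint x₀ i τ z) ^ (d + 1) := fun i =>
    Measurable.lintegral_prod_right'
      (f := fun q : ℝ × (Fin d → ℝ) => g (facePoint x₀ i q.1 q.2) ^ (d + 1))
      ((hg.comp (measurePreserving_facePoint x₀ i).measurable).pow_const _)
  have hint : ∀ i, ∫⁻ τ, (∫⁻ z, g (facePoint x₀ i τ z) ^ (d + 1)) = ∫⁻ x, g x ^ (d + 1) :=
    fun i => lintegral_lintegral_facePoint x₀ i (hg.pow_const _)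
  have hneg : ∀ i, ∫⁻ τ : ℝ, (∫⁻ z, g (facePoint x₀ i (-τ) z) ^ (d + 1)) =
      ∫⁻ x, g x ^ (d + 1) := fun i => by
    rw [← hint i]
    exact (Measure.measurePreserving_neg (volume : Measure ℝ)).lintegral_comp (hm i)
  calc ∫⁻ t, cubeEnergy x₀ g t
      ≤ ∫⁻ t, ∑ i, ((∫⁻ z, g (facePoint x₀ i t z) ^ (d + 1)) +
          ∫⁻ z, g (facePoint x₀ i (-t) z) ^ (d + 1)) :=
        lintegral_mono fun t => Finset.sum_le_sum fun i _ => add_le_add (hle i t) (hle i (-t))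
    _ = ∑ i : Fin (d + 1), ((∫⁻ x, g x ^ (d + 1)) + ∫⁻ x, g x ^ (d + 1)) := by
        refine (lintegral_finsetSum _ fun i _ => (hm i).add ((hm i).comp measurable_neg)).trans ?_
        refine Finset.sum_congr rfl fun i _ => ?_
        exact (lintegral_add_left (hm i) _).trans (congrArg₂ _ (hint i) (hneg i))
    _ < ∞ := ENNReal.sum_lt_top.2 fun i _ => ENNReal.add_lt_top.2 ⟨hfin, hfin⟩

/-- Since `∫₀ dt/t` diverges, an integrable `Φ` is `o(1/t)` along some sequence `t → 0`. -/
theorem frequently_ofReal_mul_lt {Φ : ℝ → ℝ≥0∞} (hΦ : ∫⁻ t, Φ t < ∞) {η : ℝ} (hη : 0 < η) :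
    ∃ᶠ t in 𝓝[>] (0 : ℝ), ENNReal.ofReal t * Φ t < ENNReal.ofReal η := by
  intro hev
  obtain ⟨t₀, ht₀, hsub⟩ := mem_nhdsGT_iff_exists_Ioo_subset.1 hev
  have ht₀' : (0 : ℝ) < t₀ := ht₀
  have hle : ∀ t ∈ Ioo 0 t₀, ENNReal.ofReal η * ENNReal.ofReal t⁻¹ ≤ Φ t := by
    intro t ht
    have h1 : ENNReal.ofReal η ≤ ENNReal.ofReal t * Φ t := not_lt.1 (hsub ht)
    rw [ENNReal.ofReal_inv_of_pos ht.1, ← div_eq_mul_inv]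
    exact ENNReal.div_le_of_le_mul (by rwa [mul_comm])
  have hfin : ENNReal.ofReal η * ∫⁻ t in Ioo 0 t₀, ENNReal.ofReal t⁻¹ < ∞ := by
    rw [← lintegral_const_mul' _ _ ENNReal.ofReal_ne_top]
    exact ((setLIntegral_mono' measurableSet_Ioo hle).trans
      (setLIntegral_le_lintegral _ _)).trans_lt hΦ
  have hfin' : ∫⁻ t in Ioo 0 t₀, ENNReal.ofReal t⁻¹ < ∞ :=
    ENNReal.lt_top_of_mul_ne_top_right hfin.ne (by simpa using hη)
  have hint : IntegrableOn (fun t : ℝ => t⁻¹) (Ioo 0 t₀) := by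
    refine ⟨measurable_inv.aestronglyMeasurable, ?_⟩
    rw [hasFiniteIntegral_iff_norm]
    refine lt_of_eq_of_lt (setLIntegral_congr_fun measurableSet_Ioo fun t ht => ?_) hfin'
    simp only [Real.norm_eq_abs, abs_of_pos (inv_pos.2 ht.1)]
  rw [← integrableOn_Ioc_iff_integrableOn_Ioo,
    ← intervalIntegrable_iff_integrableOn_Ioc_of_le ht₀'.le, intervalIntegrable_inv_iff] at hint
  rcases hint with h | h
  · exact ht₀'.ne h
  · exact h left_mem_uIcc

/-- Chaining of at most four faces of a cube. -/
theorem abs_sub_le_of_faces (hd : 1 ≤ d) {x₀ : 𝔼} {u : 𝔼 → ℝ} {t ω : ℝ} (ht : 0 < t)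
    (hω : ∀ i τ, |τ| = t → ∀ a b : 𝔼, supNorm (a - x₀) = t → supNorm (b - x₀) = t →
      (a - x₀) i = τ → (b - x₀) i = τ → |u b - u a| ≤ ω)
    {a b : 𝔼} (ha : supNorm (a - x₀) = t) (hb : supNorm (b - x₀) = t) :
    |u b - u a| ≤ 4 * ω := by
  set e : 𝔼 := x₀ + WithLp.toLp 2 fun _ => t with he
  have hnorm : ∀ c : Fin (d + 1) → ℝ, (∀ j, |c j| = t) →
      supNorm ((x₀ + WithLp.toLp 2 c) - x₀) = t := by
    intro c hc
    refine le_antisymm ?_ ?_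
    · exact (pi_norm_le_iff_of_nonneg ht.le).2 fun j => by simp [hc j]
    · simpa [hc 0] using abs_apply_le_supNorm ((x₀ + WithLp.toLp 2 c) - x₀) 0
  have hes : supNorm (e - x₀) = t := hnorm _ fun _ => abs_of_pos ht
  have hej : ∀ j, (e - x₀) j = t := fun j => by simp [he]
  have corner : ∀ a : 𝔼, supNorm (a - x₀) = t → |u a - u e| ≤ 2 * ω := by
    intro a ha
    obtain ⟨i, -, hi⟩ := Finset.exists_max_image Finset.univ
      (fun i => |(a - x₀) i|) Finset.univ_nonempty
    have hai : |(a - x₀) i| = t := by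
      refine le_antisymm ((abs_apply_le_supNorm _ i).trans_eq ha) ?_
      rw [← ha]
      exact (pi_norm_le_iff_of_nonneg (abs_nonneg _)).2 fun j => hi j (Finset.mem_univ j)
    have h0 : 0 ≤ ω := (abs_nonneg _).trans (hω i _ hai a a ha ha rfl rfl)
    rcases abs_eq ht.le |>.1 hai with h | h
    · have := hω i t (abs_of_pos ht) e a hes ha (hej i) h
      linarith
    · have : Nontrivial (Fin (d + 1)) := Fin.nontrivial_iff_two_le.2 (by omega)
      obtain ⟨k, hk⟩ := exists_ne i
      set c : Fin (d + 1) → ℝ := Function.update (fun _ => t) i (-t) with hc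
      set m : 𝔼 := x₀ + WithLp.toLp 2 c with hm
      have hms : supNorm (m - x₀) = t := hnorm _ fun j => by
        by_cases hj : j = i
        · subst hj; simp [hc, abs_of_pos ht]
        · simp [hc, hj, abs_of_pos ht]
      have hmi : (m - x₀) i = -t := by simp [hm, hc]
      have hmk : (m - x₀) k = t := by simp [hm, hc, hk]
      have h1 := hω i (-t) (by rw [abs_neg, abs_of_pos ht]) m a hms ha hmi h
      have h2 := hω k t (abs_of_pos ht) e m hes hms (hej k) hmk
      have h3 := abs_sub_le (u a) (u m) (u e)
      linarith
  have h1 := corner a ha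
  have h2 := corner b hb
  rw [abs_sub_comm] at h1
  have h3 := abs_sub_le (u b) (u e) (u a)
  linarith

/-- Functions with a common upper gradient in `L^{d+1}` near `x₀` have, simultaneously, small
oscillation on the boundaries of some arbitrarily small cubes around `x₀`. -/
theorem frequently_abs_sub_le (hd : 1 ≤ d) (x₀ : 𝔼) {g : 𝔼 → ℝ≥0∞} (hg : Measurable g)
    (hfin : ∫⁻ x, g x ^ (d + 1) < ∞) {R : ℝ} (hR : 0 < R) {ε : ℝ} (hε : 0 < ε) :
    ∃ᶠ t in 𝓝[>] (0 : ℝ), ∀ u : 𝔼 → ℝ, IsSegmentUpperGradient g u (puncturedCube x₀ R) →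
      ∀ a b, supNorm (a - x₀) = t → supNorm (b - x₀) = t → |u b - u a| ≤ ε := by
  set C : ℝ := 4 * (d + 1) * (morreyConst d).toReal with hC
  have hC0 : 0 ≤ C := by positivity
  -- With `t · cubeEnergy ≤ η` both terms of Morrey's estimate are at most `ε'` on each face.
  set ε' : ℝ := ε / (8 * C + 1) with hε'
  have hε'0 : 0 < ε' := by positivity
  set η : ℝ := ε' * (2 * ε') ^ d with hη
  have hη0 : 0 < η := by positivity
  have hlt : ∀ᶠ t in 𝓝[>] (0 : ℝ), t ∈ Ioo 0 R := Ioo_mem_nhdsGT hR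
  refine ((frequently_ofReal_mul_lt (lintegral_cubeEnergy_lt_top x₀ hg hfin) hη0).and_eventually
    hlt).mono ?_
  rintro t ⟨htη, ht0, htR⟩ u hu a b ha hb
  have hCe : ENNReal.ofReal (4 * (d + 1)) * morreyConst d = ENNReal.ofReal C := by
    rw [hC, ENNReal.ofReal_mul (p := 4 * ((d : ℝ) + 1)) (by positivity),
      ENNReal.ofReal_toReal (morreyConst_ne_top d)]
  refine (abs_sub_le_of_faces hd ht0 (ω := C * (2 * ε')) ?_ ha hb).trans ?_
  · intro i τ hτ a b ha hb hai hbi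
    obtain ⟨z, hz, hza⟩ := exists_eq_facePoint (x₀ := x₀) (x := a) (i := i)
    obtain ⟨z', hz', hzb⟩ := exists_eq_facePoint (x₀ := x₀) (x := b) (i := i)
    rw [ha, ← hτ] at hz
    rw [hb, ← hτ] at hz'
    rw [hai] at hza
    rw [hbi] at hzb
    have h1 := ofReal_abs_sub_facePoint_le hg hu i (by rwa [hτ]) (by rwa [hτ]) hz hz' hε'0
    rw [← hza, ← hzb, hCe] at h1
    have h2 : ENNReal.ofReal |τ| * faceEnergy x₀ g i τ ≤ ENNReal.ofReal η := by
      refine le_trans ?_ htη.le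
      have := faceEnergy_le_cubeEnergy x₀ g i τ
      rw [hτ] at this ⊢
      gcongr
    have h3 : ENNReal.ofReal |u b - u a| ≤ ENNReal.ofReal (C * (2 * ε')) := by
      calc _ ≤ _ := h1
        _ ≤ ENNReal.ofReal C * (ENNReal.ofReal ε' + ENNReal.ofReal ((2 * ε') ^ d)⁻¹ *
              ENNReal.ofReal η) := by gcongr
        _ = _ := by
            rw [← ENNReal.ofReal_mul (by positivity), ← ENNReal.ofReal_add (by positivity)
              (by positivity), ← ENNReal.ofReal_mul hC0]
            congr 2
            rw [hη]
            field_simp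
            ring
    exact (ENNReal.ofReal_le_ofReal_iff (by positivity)).1 h3
  · have : 4 * (C * (2 * ε')) = ε * (8 * C / (8 * C + 1)) := by rw [hε']; ring
    rw [this]
    exact mul_le_of_le_one_right hε.le ((div_le_one (by positivity)).2 (by linarith))

end Faces

/-! ### Open maps on shells -/

section Shells

variable {n : ℕ}

local notation "𝔼" => EuclideanSpace ℝ (Fin n)

theorem isOpen_puncturedCube (x₀ : 𝔼) (R : ℝ) : IsOpen (puncturedCube x₀ R) := by
  have hc : Continuous fun x : 𝔼 => supNorm (x - x₀) :=
    continuous_supNorm.comp (continuous_id.sub continuous_const)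
  exact (isOpen_lt continuous_const hc).inter (isOpen_lt hc continuous_const)

theorem puncturedCube_mono (x₀ : 𝔼) {r R : ℝ} (h : r ≤ R) :
    puncturedCube x₀ r ⊆ puncturedCube x₀ R := fun _ hx => ⟨hx.1, hx.2.trans_le h⟩

theorem puncturedCube_mem_nhdsNE (x₀ : 𝔼) {R : ℝ} (hR : 0 < R) : puncturedCube x₀ R ∈ 𝓝[≠] x₀ := by
  have hc : Continuous fun x : 𝔼 => supNorm (x - x₀) :=
    continuous_supNorm.comp (continuous_id.sub continuous_const)
  have h1 : ∀ᶠ x in 𝓝 x₀, supNorm (x - x₀) < R :=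
    hc.continuousAt.eventually_lt continuousAt_const (by simpa [supNorm] using hR)
  filter_upwards [mem_nhdsWithin_of_mem_nhds h1, self_mem_nhdsWithin] with x hx hne
  refine ⟨lt_of_le_of_ne (supNorm_nonneg _) fun h => hne ?_, hx⟩
  exact sub_eq_zero.1 (supNorm_eq_zero.1 h.symm)

theorem puncturedCube_subset_closedBall (x₀ : 𝔼) (R : ℝ) :
    puncturedCube x₀ R ⊆ Metric.closedBall x₀ (n * R) := by
  intro x hx
  rw [mem_closedBall_iff_norm]
  exact (norm_le_mul_supNorm _).trans (by gcongr; exact hx.2.le)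

theorem isCompact_shell (x₀ : 𝔼) (s t : ℝ) :
    IsCompact {x : 𝔼 | s ≤ supNorm (x - x₀) ∧ supNorm (x - x₀) ≤ t} := by
  have hc : Continuous fun x : 𝔼 => supNorm (x - x₀) :=
    continuous_supNorm.comp (continuous_id.sub continuous_const)
  refine Metric.isCompact_of_isClosed_isBounded
    ((isClosed_le continuous_const hc).inter (isClosed_le hc continuous_const)) ?_
  refine (Metric.isBounded_closedBall (x := x₀) (r := n * t)).subset fun x hx => ?_
  rw [mem_closedBall_iff_norm]
  exact (norm_le_mul_supNorm _).trans (by gcongr; exact hx.2)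

theorem isOpen_openShell (x₀ : 𝔼) (s t : ℝ) :
    IsOpen {x : 𝔼 | s < supNorm (x - x₀) ∧ supNorm (x - x₀) < t} := by
  have hc : Continuous fun x : 𝔼 => supNorm (x - x₀) :=
    continuous_supNorm.comp (continuous_id.sub continuous_const)
  exact (isOpen_lt continuous_const hc).inter (isOpen_lt hc continuous_const)

/-- The distance to a point has no local maxima. -/
theorem frequently_dist_lt {F : Type*} [NormedAddCommGroup F] [NormedSpace ℝ F] [Nontrivial F]
    (a y : F) : ∃ᶠ y' in 𝓝 y, dist y a < dist y' a := by
  obtain ⟨v, c, hv, hc, hy⟩ : ∃ (v : F) (c : ℝ), v ≠ 0 ∧ 0 ≤ c ∧ y - a = c • v := by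
    by_cases h : y = a
    · obtain ⟨v, hv⟩ := exists_ne (0 : F)
      exact ⟨v, 0, hv, le_rfl, by simp [h]⟩
    · exact ⟨y - a, 1, sub_ne_zero.2 h, zero_le_one, by simp⟩
  have ht : Tendsto (fun δ : ℝ => y + δ • v) (𝓝[>] 0) (𝓝 y) := by
    have : Continuous fun δ : ℝ => y + δ • v := by fun_prop
    simpa using (this.tendsto 0).mono_left nhdsWithin_le_nhds
  refine ht.frequently (Eventually.frequently ?_)
  filter_upwards [self_mem_nhdsWithin] with δ hδ
  have hδ' : 0 < δ := hδ
  rw [dist_eq_norm, dist_eq_norm, hy, show y + δ • v - a = (c + δ) • v by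
    rw [add_smul, ← hy]; abel, norm_smul, norm_smul, Real.norm_of_nonneg hc,
    Real.norm_of_nonneg (by positivity)]
  have := norm_pos_iff.2 hv
  nlinarith

variable {F : Type*} [TopologicalSpace F] {f : EuclideanSpace ℝ (Fin n) → F}
  {x₀ : EuclideanSpace ℝ (Fin n)} {R : ℝ}

/-- Maximum principle for open maps on a shell. -/
theorem le_of_le_on_shell_boundary (hf : ContinuousOn f (puncturedCube x₀ R))
    (hopen : ∀ V ⊆ puncturedCube x₀ R, IsOpen V → IsOpen (f '' V)) {φ : F → ℝ}
    (hφ : Continuous φ) (hmax : ∀ y, ∃ᶠ y' in 𝓝 y, φ y < φ y') {s t M : ℝ} (hs : 0 < s)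
    (ht : t < R) (hsM : ∀ x, supNorm (x - x₀) = s → φ (f x) ≤ M)
    (htM : ∀ x, supNorm (x - x₀) = t → φ (f x) ≤ M) {x : 𝔼} (hx1 : s ≤ supNorm (x - x₀))
    (hx2 : supNorm (x - x₀) ≤ t) : φ (f x) ≤ M := by
  have hsub : {x : 𝔼 | s ≤ supNorm (x - x₀) ∧ supNorm (x - x₀) ≤ t} ⊆ puncturedCube x₀ R :=
    fun x hx => ⟨hs.trans_le hx.1, hx.2.trans_lt ht⟩
  obtain ⟨z, hz, hzmax⟩ := (isCompact_shell x₀ s t).exists_isMaxOn ⟨x, hx1, hx2⟩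
    (hφ.comp_continuousOn (hf.mono hsub))
  refine (hzmax (show x ∈ _ from ⟨hx1, hx2⟩)).trans ?_
  show φ (f z) ≤ M
  rcases hz.1.eq_or_lt with h1 | h1
  · exact hsM z h1.symm
  rcases hz.2.eq_or_lt with h2 | h2
  · exact htM z h2
  exfalso
  have hV := hopen {x : 𝔼 | s < supNorm (x - x₀) ∧ supNorm (x - x₀) < t}
    (fun x hx => hsub ⟨hx.1.le, hx.2.le⟩) (isOpen_openShell x₀ s t)
  obtain ⟨_, hlt, z', hz', rfl⟩ :=
    ((hmax (f z)).and_eventually (hV.mem_nhds ⟨z, ⟨h1, h2⟩, rfl⟩)).exists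
  exact (hzmax (show z' ∈ _ from ⟨hz'.1.le, hz'.2.le⟩)).not_gt hlt

/-- A connected set that misses the image of the boundary of a shell and meets the image of its
interior is covered by the latter. -/
theorem subset_image_openShell (hf : ContinuousOn f (puncturedCube x₀ R)) [T2Space F]
    (hopen : ∀ V ⊆ puncturedCube x₀ R, IsOpen V → IsOpen (f '' V)) {S : Set F}
    (hS : IsPreconnected S) {s t : ℝ} (hs : 0 < s)
    (ht : t < R) (hsS : ∀ x, supNorm (x - x₀) = s → f x ∉ S)
    (htS : ∀ x, supNorm (x - x₀) = t → f x ∉ S) {x : 𝔼} (hx1 : s ≤ supNorm (x - x₀))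
    (hx2 : supNorm (x - x₀) ≤ t) (hx : f x ∈ S) :
    S ⊆ f '' {x : 𝔼 | s < supNorm (x - x₀) ∧ supNorm (x - x₀) < t} := by
  have hsub : {x : 𝔼 | s ≤ supNorm (x - x₀) ∧ supNorm (x - x₀) ≤ t} ⊆ puncturedCube x₀ R :=
    fun x hx => ⟨hs.trans_le hx.1, hx.2.trans_lt ht⟩
  have hcl : IsClosed (f '' {x : 𝔼 | s ≤ supNorm (x - x₀) ∧ supNorm (x - x₀) ≤ t}) :=
    ((isCompact_shell x₀ s t).image_of_continuousOn (hf.mono hsub)).isClosed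
  have hV := hopen {x : 𝔼 | s < supNorm (x - x₀) ∧ supNorm (x - x₀) < t}
    (fun x hx => hsub ⟨hx.1.le, hx.2.le⟩) (isOpen_openShell x₀ s t)
  have hint : ∀ z, s ≤ supNorm (z - x₀) → supNorm (z - x₀) ≤ t → f z ∈ S →
      f z ∈ f '' {x : 𝔼 | s < supNorm (x - x₀) ∧ supNorm (x - x₀) < t} := by
    intro z h1 h2 hz
    rcases h1.eq_or_lt with h1 | h1
    · exact absurd hz (hsS z h1.symm)
    rcases h2.eq_or_lt with h2 | h2
    · exact absurd hz (htS z h2)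
    exact ⟨z, ⟨h1, h2⟩, rfl⟩
  refine hS.subset_left_of_subset_union hV hcl.isOpen_compl ?_ ?_ ⟨f x, hx, hint x hx1 hx2 hx⟩
  · refine Disjoint.mono_left ?_ disjoint_compl_right
    exact image_mono fun z hz => ⟨hz.1.le, hz.2.le⟩
  · intro y hy
    by_cases h : y ∈ f '' {x : 𝔼 | s ≤ supNorm (x - x₀) ∧ supNorm (x - x₀) ≤ t}
    · obtain ⟨z, hz, rfl⟩ := h
      exact Or.inl (hint z hz.1 hz.2 hy)
    · exact Or.inr h

/-- A bound on arbitrarily small cube boundaries propagates to a punctured neighbourhood. -/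
theorem exists_forall_mem_puncturedCube_le (hf : ContinuousOn f (puncturedCube x₀ R))
    (hopen : ∀ V ⊆ puncturedCube x₀ R, IsOpen V → IsOpen (f '' V)) (hR : 0 < R) {φ : F → ℝ}
    (hφ : Continuous φ) (hmax : ∀ y, ∃ᶠ y' in 𝓝 y, φ y < φ y') {M : ℝ}
    (hM : ∃ᶠ t in 𝓝[>] (0 : ℝ), ∀ x, supNorm (x - x₀) = t → φ (f x) ≤ M) :
    ∃ r, 0 < r ∧ r ≤ R ∧ ∀ x ∈ puncturedCube x₀ r, φ (f x) ≤ M := by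
  obtain ⟨t, htM, ht0, htR⟩ := (hM.and_eventually (Ioo_mem_nhdsGT hR)).exists
  refine ⟨t, ht0, htR.le, fun x hx => ?_⟩
  obtain ⟨s, hsM, hs0, hsx⟩ := (hM.and_eventually (Ioo_mem_nhdsGT hx.1)).exists
  exact le_of_le_on_shell_boundary hf hopen hφ hmax hs0 htR hsM htM hsx.le hx.2.le

theorem subset_image_puncturedCube (hf : ContinuousOn f (puncturedCube x₀ R)) [T2Space F]
    (hopen : ∀ V ⊆ puncturedCube x₀ R, IsOpen V → IsOpen (f '' V)) {S : Set F}
    (hS : IsPreconnected S) (hmiss : ∃ᶠ t in 𝓝[>] (0 : ℝ), ∀ x, supNorm (x - x₀) = t → f x ∉ S)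
    (hhit : ∃ᶠ x in 𝓝[≠] x₀, f x ∈ S) {r : ℝ} (hr : 0 < r) (hrR : r ≤ R) :
    S ⊆ f '' puncturedCube x₀ r := by
  obtain ⟨t, htS, ht0, htr⟩ := (hmiss.and_eventually (Ioo_mem_nhdsGT hr)).exists
  obtain ⟨x, hxS, hx0, hxt⟩ :=
    (hhit.and_eventually (puncturedCube_mem_nhdsNE x₀ ht0)).exists
  obtain ⟨s, hsS, hs0, hsx⟩ := (hmiss.and_eventually (Ioo_mem_nhdsGT hx0)).exists
  refine (subset_image_openShell hf hopen hS hs0 (htr.trans_le hrR) hsS htS hsx.le hxt.le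
    hxS).trans (image_mono fun z hz => ⟨hs0.trans hz.1, hz.2.trans htr⟩)

end Shells

/-- If an open map into a compact set has small oscillation on the boundaries of arbitrarily small
cubes around `x₀`, then it has a limit at `x₀`. -/
theorem exists_tendsto_of_frequently_dist_le {n : ℕ} {x₀ : EuclideanSpace ℝ (Fin n)} {R : ℝ}
    {F : Type*} [NormedAddCommGroup F] [NormedSpace ℝ F] [Nontrivial F]
    {f : EuclideanSpace ℝ (Fin n) → F} {K : Set F}
    (hn : 0 < n) (hf : ContinuousOn f (puncturedCube x₀ R))
    (hopen : ∀ V ⊆ puncturedCube x₀ R, IsOpen V → IsOpen (f '' V)) (hR : 0 < R)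
    (hK : IsCompact K) (hfK : MapsTo f (puncturedCube x₀ R) K)
    (hosc : ∀ ε > 0, ∃ᶠ t in 𝓝[>] (0 : ℝ), ∀ a b, supNorm (a - x₀) = t → supNorm (b - x₀) = t →
      dist (f b) (f a) ≤ ε) :
    ∃ y, Tendsto f (𝓝[≠] x₀) (𝓝 y) := by
  have hone : ∀ j : ℕ, (0 : ℝ) < 1 / (j + 1) := fun j => by positivity
  have hex : ∀ j : ℕ, ∃ t, (∀ a b, supNorm (a - x₀) = t → supNorm (b - x₀) = t →
      dist (f b) (f a) ≤ 1 / (j + 1)) ∧ t ∈ Ioo 0 (1 / ((j : ℝ) + 1)) ∧ t ∈ Ioo 0 R := fun j =>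
    ((hosc _ (hone j)).and_eventually
      (inter_mem (Ioo_mem_nhdsGT (hone j)) (Ioo_mem_nhdsGT hR))).exists
  choose t htosc htj htR using hex
  set e : ℕ → EuclideanSpace ℝ (Fin n) := fun j => x₀ + WithLp.toLp 2 fun _ => t j with he
  have : Nonempty (Fin n) := ⟨⟨0, hn⟩⟩
  have hes : ∀ j, supNorm (e j - x₀) = t j := fun j => by
    simp [he, supNorm, abs_of_pos (htj j).1]
  obtain ⟨y, -, ψ, hψ, hlim⟩ := hK.tendsto_subseq fun j =>
    hfK (show e j ∈ puncturedCube x₀ R from ⟨by rw [hes]; exact (htj j).1,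
      by rw [hes]; exact (htR j).2⟩)
  refine ⟨y, Metric.tendsto_nhds.2 fun ε hε => ?_⟩
  have hinv : Tendsto (fun k => 1 / ((ψ k : ℝ) + 1)) atTop (𝓝 0) :=
    tendsto_one_div_add_atTop_nhds_zero_nat.comp hψ.tendsto_atTop
  have htlim : Tendsto (fun k => t (ψ k)) atTop (𝓝[>] 0) := by
    refine tendsto_nhdsWithin_iff.2 ⟨squeeze_zero (fun k => (htj _).1.le) (fun k => (htj _).2.le)
      hinv, .of_forall fun k => (htj _).1⟩
  have hfreq : ∃ᶠ s in 𝓝[>] (0 : ℝ), ∀ x, supNorm (x - x₀) = s → dist (f x) y ≤ ε / 2 := by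
    refine htlim.frequently (Eventually.frequently ?_)
    filter_upwards [hinv.eventually_lt_const (show (0 : ℝ) < ε / 4 by positivity),
      Metric.tendsto_nhds.1 hlim (ε / 4) (by positivity)] with k hk1 hk2 x hx
    have h1 := htosc (ψ k) (e (ψ k)) x (hes _) hx
    have h2 := dist_triangle (f x) (f (e (ψ k))) y
    simp only [Function.comp_apply] at hk2
    linarith
  obtain ⟨r, hr0, -, hr⟩ := exists_forall_mem_puncturedCube_le hf hopen hR
    (φ := fun z => dist z y) (by fun_prop) (frequently_dist_lt y) hfreq
  filter_upwards [puncturedCube_mem_nhdsNE x₀ hr0] with x hx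
  exact (hr x hx).trans_lt (by linarith)

/-! ### Maps of finite length distortion near an isolated singularity -/

section Singularity

variable {n : ℕ} {f : EuclideanSpace ℝ (Fin n) → EuclideanSpace ℝ (Fin n)}
  {x₀ : EuclideanSpace ℝ (Fin n)} {R p : ℝ} {G T : Set (EuclideanSpace ℝ (Fin n))}

theorem measurableSet_puncturedCube_inter_preimage (hf : ContinuousOn f (puncturedCube x₀ R))
    (hT : IsClosed T) : MeasurableSet (puncturedCube x₀ R ∩ f ⁻¹' T) := by
  have h1 := hf.isOpen_inter_preimage (isOpen_puncturedCube x₀ R) hT.isOpen_compl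
  have h2 : puncturedCube x₀ R ∩ f ⁻¹' T =
      puncturedCube x₀ R \ (puncturedCube x₀ R ∩ f ⁻¹' Tᶜ) := by
    ext x
    simp only [mem_inter_iff, mem_preimage, Set.mem_sdiff, mem_compl_iff]
    tauto
  rw [h2]
  exact (isOpen_puncturedCube x₀ R).measurableSet.diff h1.measurableSet

theorem volume_puncturedCube_lt_top : volume (puncturedCube x₀ R) < ∞ :=
  (measure_mono (puncturedCube_subset_closedBall x₀ R)).trans_lt measure_closedBall_lt_top

/-- If `‖f'‖ᵖ` is integrable over the part of a punctured cube that is mapped into `T`, then all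
compositions `w ∘ f`, with `w` `1`-Lipschitz and locally constant off `T`, have a common upper
gradient in `Lⁿ`. -/
theorem exists_isSegmentUpperGradient (hn : 0 < n) (hp : (n : ℝ) ≤ p) (hL : LOne p f G)
    (hG : puncturedCube x₀ R ⊆ G) (hf : ContinuousOn f (puncturedCube x₀ R)) (hT : IsClosed T)
    (hfin : ∫⁻ x in puncturedCube x₀ R ∩ f ⁻¹' T, derivNorm f x ^ p < ∞) :
    ∃ g : EuclideanSpace ℝ (Fin n) → ℝ≥0∞, Measurable g ∧ ∫⁻ x, g x ^ n < ∞ ∧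
      ∀ w : EuclideanSpace ℝ (Fin n) → ℝ, LipschitzWith 1 w → ∀ S ⊆ puncturedCube x₀ R,
        (∀ x ∈ S, f x ∉ T → ∀ᶠ y in 𝓝 (f x), w y = w (f x)) →
        IsSegmentUpperGradient g (fun x => w (f x)) S := by
  set P := puncturedCube x₀ R with hP
  set A := P ∩ f ⁻¹' T with hA
  have hn1 : (1 : ℝ) ≤ n := by exact_mod_cast hn
  have hp1 : 1 ≤ p := hn1.trans hp
  have hp0 : 0 < p := zero_lt_one.trans_le hp1
  have hAm : MeasurableSet A := measurableSet_puncturedCube_inter_preimage hf hT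
  have hPm : MeasurableSet P := (isOpen_puncturedCube x₀ R).measurableSet
  obtain ⟨h, hhm, hhp, hhex⟩ := exists_lintegral_rpow_lt_top_of_pModulus_eq_zero hp0 hL
  set k := A.indicator (derivNorm f) with hk
  have hkm : Measurable k := (measurable_derivNorm f).indicator hAm
  refine ⟨P.indicator (k + h), (hkm.add hhm).indicator hPm, ?_, ?_⟩
  · have hkp : ∫⁻ x, k x ^ p < ∞ := by
      have : (fun x => k x ^ p) = A.indicator fun x => derivNorm f x ^ p := by
        funext x
        by_cases hx : x ∈ A <;> simp [hk, hx, hp0]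
      rw [this, lintegral_indicator hAm]
      exact hfin
    have hpt : ∀ x, P.indicator (k + h) x ^ n ≤
        P.indicator 1 x + 2 ^ (p - 1) * (k x ^ p + h x ^ p) := by
      intro x
      by_cases hx : x ∈ P
      · rw [indicator_of_mem hx, indicator_of_mem hx, Pi.one_apply]
        have h1 : ∀ z : ℝ≥0∞, z ^ n ≤ 1 + z ^ p := fun z => by
          rcases le_total z 1 with hz | hz
          · exact (pow_le_one₀ zero_le hz).trans le_self_add
          · rw [← ENNReal.rpow_natCast]
            exact (ENNReal.rpow_le_rpow_of_exponent_le hz hp).trans le_add_self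
        exact (h1 _).trans (add_le_add le_rfl (ENNReal.rpow_add_le_mul_rpow_add_rpow _ _ hp1))
      · rw [indicator_of_notMem hx, zero_pow hn.ne']
        exact zero_le
    have h2 : (2 : ℝ≥0∞) ^ (p - 1) < ∞ :=
      ENNReal.rpow_lt_top_of_nonneg (by linarith) ENNReal.ofNat_ne_top
    refine (lintegral_mono hpt).trans_lt ?_
    rw [lintegral_add_left (measurable_one.indicator hPm), lintegral_indicator_one hPm,
      lintegral_const_mul' _ _ h2.ne, lintegral_add_left (hkm.pow_const p)]
    exact ENNReal.add_lt_top.2 ⟨volume_puncturedCube_lt_top,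
      ENNReal.mul_lt_top h2 (ENNReal.add_lt_top.2 ⟨hkp, hhp⟩)⟩
  · intro w hw S hS hwT a b hab
    have key := ofReal_abs_sub_le_of_lOne (T := T) (g := k) (h := h) (isOpen_puncturedCube x₀ R) hf
      (fun x hx hxT => by rw [hk, indicator_of_mem (show x ∈ A from ⟨hx, hxT⟩)])
      (fun γ hγ hr hnot => hhex γ ⟨fun t ht => hG (hγ ht), hnot⟩ hr) hw (hab.trans hS)
      fun x hx => hwT x (hab hx)
    refine key.trans_eq ?_
    congr 1
    refine setLIntegral_congr_fun measurableSet_Icc fun s hs => ?_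
    have : a + s • (b - a) ∈ segment ℝ a b := by
      rw [segment_eq_image']
      exact ⟨s, hs, rfl⟩
    rw [indicator_of_mem (hS (hab this))]

theorem tendsto_volume_closedBall_zero (x₀ : EuclideanSpace ℝ (Fin n)) (hn : 0 < n) :
    Tendsto (fun r : ℝ => volume (Metric.closedBall x₀ (n * r))) (𝓝[>] 0) (𝓝 0) := by
  have h1 : ∀ r ∈ Ioi (0 : ℝ), volume (Metric.closedBall x₀ (n * r)) =
      ENNReal.ofReal ((n * r) ^ n) *
        volume (Metric.closedBall (0 : EuclideanSpace ℝ (Fin n)) 1) := fun r hr => by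
    have hr' : 0 < r := hr
    rw [Measure.addHaar_closedBall' volume x₀ (by positivity), finrank_euclideanSpace_fin]
  refine Tendsto.congr' (f₁ := fun r : ℝ => ENNReal.ofReal ((n * r) ^ n) *
    volume (Metric.closedBall (0 : EuclideanSpace ℝ (Fin n)) 1))
    (eventually_of_mem self_mem_nhdsWithin fun r hr => (h1 r hr).symm) ?_
  have hc : Continuous fun r : ℝ => ENNReal.ofReal ((n * r) ^ n) :=
    ENNReal.continuous_ofReal.comp (by fun_prop)
  have h2 : Tendsto (fun r : ℝ => ENNReal.ofReal ((n * r) ^ n)) (𝓝[>] 0) (𝓝 0) := by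
    have := (hc.tendsto 0).mono_left (nhdsWithin_le_nhds (s := Ioi 0))
    simpa [hn.ne'] using this
  simpa using ENNReal.Tendsto.mul_const h2 (Or.inr measure_closedBall_lt_top.ne)

/-- If `‖f'‖ᵖ` is integrable over the part of a punctured cube that is mapped into `T`, then the
images of small punctured cubes fill little of `T`. -/
theorem exists_volume_image_puncturedCube_inter_lt (hn : 0 < n) (hp : (n : ℝ) ≤ p)
    (hd : ∀ᵐ x, x ∈ G → DifferentiableAt ℝ f x) (hN : LuzinNOn f G)
    (hG : puncturedCube x₀ R ⊆ G) (hf : ContinuousOn f (puncturedCube x₀ R)) (hR : 0 < R)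
    (hT : IsClosed T)
    (hfin : ∫⁻ x in puncturedCube x₀ R ∩ f ⁻¹' T, derivNorm f x ^ p < ∞) {ε : ℝ≥0∞} (hε : ε ≠ 0) :
    ∃ r, 0 < r ∧ r ≤ R ∧ volume (f '' puncturedCube x₀ r ∩ T) < ε := by
  set A := puncturedCube x₀ R ∩ f ⁻¹' T with hA
  have hAm : MeasurableSet A := measurableSet_puncturedCube_inter_preimage hf hT
  have htot : ∫⁻ x in A, (1 + derivNorm f x ^ p) ≠ ∞ := by
    rw [lintegral_add_left measurable_const, setLIntegral_one]
    exact (ENNReal.add_lt_top.2 ⟨(measure_mono inter_subset_left).trans_lt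
      volume_puncturedCube_lt_top, hfin⟩).ne
  have hsmall := tendsto_setLIntegral_zero htot (l := 𝓝[>] (0 : ℝ))
    (s := fun r : ℝ => Metric.closedBall x₀ (n * r))
    (tendsto_of_tendsto_of_tendsto_of_le_of_le tendsto_const_nhds
      (tendsto_volume_closedBall_zero x₀ hn) (fun _ => zero_le)
      fun r => Measure.restrict_apply_le _ _)
  obtain ⟨r, hrε, hr0, hrR⟩ := ((hsmall.eventually_lt_const (pos_iff_ne_zero.2 hε)).and
    (Ioo_mem_nhdsGT hR)).exists
  refine ⟨r, hr0, hrR.le, lt_of_le_of_lt ?_ hrε⟩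
  set B := puncturedCube x₀ r ∩ f ⁻¹' T with hB
  have hrR' := puncturedCube_mono x₀ hrR.le
  have hBm : MeasurableSet B :=
    measurableSet_puncturedCube_inter_preimage (hf.mono hrR') hT
  have hsub : f '' puncturedCube x₀ r ∩ T ⊆ f '' B := by
    rintro _ ⟨⟨x, hx, rfl⟩, hxT⟩
    exact ⟨x, ⟨hx, hxT⟩, rfl⟩
  calc volume (f '' puncturedCube x₀ r ∩ T) ≤ volume (f '' B) := measure_mono hsub
    _ ≤ ∫⁻ x in B, (1 + derivNorm f x ^ p) :=
        volume_image_le_lintegral_one_add_derivNorm_rpow hp hd hN hBm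
          fun x hx => hG (hrR' hx.1)
    _ ≤ ∫⁻ x in Metric.closedBall x₀ (n * r) ∩ A, (1 + derivNorm f x ^ p) :=
        lintegral_mono_set fun x hx =>
          ⟨puncturedCube_subset_closedBall x₀ r hx.1, hrR' hx.1, hx.2⟩
    _ = _ := by
        rw [Measure.restrict_restrict Metric.isClosed_closedBall.measurableSet]

end Singularity

/-! ### Integrals of the inner dilatation near cluster points -/

section ClusterPoints

variable {n : ℕ} {f : EuclideanSpace ℝ (Fin n) → EuclideanSpace ℝ (Fin n)}
  {x₀ : EuclideanSpace ℝ (Fin n)} {R p q : ℝ} {G T : Set (EuclideanSpace ℝ (Fin n))}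

theorem OpenDiscreteOn.isOpen_image_puncturedCube (h : OpenDiscreteOn f G)
    (hG : puncturedCube x₀ R ⊆ G) :
    ∀ V ⊆ puncturedCube x₀ R, IsOpen V → IsOpen (f '' V) :=
  fun V hV hVo => h.isOpen_image V (hV.trans hG) hVo

/-- A connected set of positive volume in `T` cannot contain images of points arbitrarily close to
`x₀` and miss the images of the boundaries of arbitrarily small cubes: it would be covered by the
image of every small punctured cube. -/
theorem false_of_frequently_notMem (hn : 0 < n) (hp : (n : ℝ) ≤ p) (hf : OpenDiscreteOn f G)
    (hfld : FiniteLengthDistortion p q f G) (hR : 0 < R) (hG : puncturedCube x₀ R ⊆ G)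
    (hT : IsClosed T)
    (hfin : ∫⁻ x in puncturedCube x₀ R ∩ f ⁻¹' T, derivNorm f x ^ p < ∞)
    {S : Set (EuclideanSpace ℝ (Fin n))} (hS : IsPreconnected S) (hST : volume (S ∩ T) ≠ 0)
    (hmiss : ∃ᶠ t in 𝓝[>] (0 : ℝ), ∀ x, supNorm (x - x₀) = t → f x ∉ S)
    (hhit : ∃ᶠ x in 𝓝[≠] x₀, f x ∈ S) : False := by
  have hfc := hf.continuousOn.mono hG
  obtain ⟨r, hr0, hrR, hr⟩ := exists_volume_image_puncturedCube_inter_lt hn hp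
    hfld.ae_differentiable hfld.luzinN hG hfc hR hT hfin hST
  have hsub := subset_image_puncturedCube hfc (hf.isOpen_image_puncturedCube hG) hS hmiss hhit
    hr0 hrR
  exact hr.not_ge (measure_mono (inter_subset_inter_left T hsub))

/-- If `‖f'‖ᵖ` is integrable over the part of a punctured cube mapped into a ball about a finite
cluster value `y`, then `f` has a finite limit. -/
theorem exists_tendsto_of_frequently_mem_ball (hn : 2 ≤ n) (hp : (n : ℝ) ≤ p)
    (hf : OpenDiscreteOn f G) (hfld : FiniteLengthDistortion p q f G) (hR : 0 < R)
    (hG : puncturedCube x₀ R ⊆ G) {y : EuclideanSpace ℝ (Fin n)} {r : ℝ} (hr : 0 < r)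
    (hfin : ∫⁻ x in puncturedCube x₀ R ∩ f ⁻¹' Metric.closedBall y r, derivNorm f x ^ p < ∞)
    (hhit : ∃ᶠ x in 𝓝[≠] x₀, f x ∈ Metric.ball y (r / 2)) :
    ∃ a, Tendsto f (𝓝[≠] x₀) (𝓝 a) := by
  obtain ⟨d, rfl⟩ : ∃ d, n = d + 1 := ⟨n - 1, by omega⟩
  have hd : 1 ≤ d := by omega
  have : Nontrivial (EuclideanSpace ℝ (Fin (d + 1))) := by
    apply Module.nontrivial_of_finrank_pos (R := ℝ)
    simp
  have hfc := hf.continuousOn.mono hG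
  have hT : IsClosed (Metric.closedBall y r) := Metric.isClosed_closedBall
  obtain ⟨g, hgm, hgfin, hg⟩ :=
    exists_isSegmentUpperGradient (Nat.succ_pos d) hp hfld.lOne hG hfc hT hfin
  -- The truncated distance `min (|· - y|) r` is constant off the ball.
  have hw : LipschitzWith 1 fun z : EuclideanSpace ℝ (Fin (d + 1)) => min (dist z y) r :=
    (LipschitzWith.dist_left y).min_const r
  have hgrad := hg _ hw _ Subset.rfl fun x _ hxT => by
    have hx : r < dist (f x) y := by simpa using hxT
    have hc : ContinuousAt (fun z => dist z y) (f x) := by fun_prop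
    filter_upwards [hc.eventually_const_lt hx] with z hz
    rw [min_eq_right hz.le, min_eq_right hx.le]
  have hfreq := (frequently_abs_sub_le hd x₀ hgm hgfin hR
    (show 0 < r / 4 by positivity)).mono fun t ht => ht _ hgrad
  have hcases : ∃ᶠ t in 𝓝[>] (0 : ℝ),
      (∀ x, supNorm (x - x₀) = t → dist (f x) y ≤ 3 * r / 4) ∨
      ∀ x, supNorm (x - x₀) = t → f x ∉ Metric.ball y (r / 2) := by
    refine hfreq.mono fun t ht => ?_
    by_contra hcon
    simp only [not_or, not_forall, not_le, not_not, Metric.mem_ball] at hcon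
    obtain ⟨⟨a, ha, hay⟩, b, hb, hby⟩ := hcon
    have h1 := (le_abs_self _).trans (ht b a hb ha)
    have h2 : 3 * r / 4 < min (dist (f a) y) r := lt_min hay (by linarith)
    have h3 : min (dist (f b) y) r < r / 2 := (min_le_left _ _).trans_lt hby
    linarith
  rcases frequently_or_distrib.1 hcases with hA | hB
  · obtain ⟨ρ, hρ0, hρR, hρ⟩ := exists_forall_mem_puncturedCube_le hfc
      (hf.isOpen_image_puncturedCube hG) hR (φ := fun z => dist z y) (by fun_prop)
      (frequently_dist_lt y) hA
    have hsub := puncturedCube_mono x₀ hρR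
    have hmaps : MapsTo f (puncturedCube x₀ ρ) (Metric.closedBall y r) := fun x hx =>
      Metric.mem_closedBall.2 ((hρ x hx).trans (by linarith))
    refine exists_tendsto_of_frequently_dist_le (Nat.succ_pos d) (hfc.mono hsub)
      (hf.isOpen_image_puncturedCube (hsub.trans hG)) hρ0 (isCompact_closedBall y r) hmaps
      fun ε hε => (frequently_abs_sub_le hd x₀ hgm hgfin hρ0 hε).mono fun t ht a b ha hb => ?_
    -- The test function `|· - f a|` may depend on the cube.
    have h1 := ht _ (hg (fun z => dist z (f a)) (LipschitzWith.dist_left _) _ hsub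
      fun x hx hxT => absurd (hmaps hx) hxT) a b ha hb
    simpa using h1
  · exfalso
    refine false_of_frequently_notMem (Nat.succ_pos d) hp hf hfld hR hG hT hfin
      (convex_ball y (r / 2)).isPreconnected ?_ hB hhit
    rw [inter_eq_left.2 (Metric.ball_subset_closedBall.trans
      (Metric.closedBall_subset_closedBall (by linarith)))]
    exact (Metric.measure_ball_pos volume y (by positivity)).ne'

/-- If `‖f'‖ᵖ` is integrable over the part of a punctured cube mapped into a neighbourhood of the
cluster value `∞`, then `f` tends to `∞`. -/
theorem tendsto_norm_atTop_of_frequently_lt_norm (hn : 2 ≤ n) (hp : (n : ℝ) ≤ p)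
    (hf : OpenDiscreteOn f G) (hfld : FiniteLengthDistortion p q f G) (hR : 0 < R)
    (hG : puncturedCube x₀ R ⊆ G) {r : ℝ} (hr : 0 ≤ r)
    (hfin : ∫⁻ x in puncturedCube x₀ R ∩ f ⁻¹' {z | r ≤ ‖z‖}, derivNorm f x ^ p < ∞)
    (hhit : ∀ M : ℝ, ∃ᶠ x in 𝓝[≠] x₀, M < ‖f x‖) :
    Tendsto (fun x => ‖f x‖) (𝓝[≠] x₀) atTop := by
  obtain ⟨d, rfl⟩ : ∃ d, n = d + 1 := ⟨n - 1, by omega⟩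
  have hd : 1 ≤ d := by omega
  have : Nontrivial (EuclideanSpace ℝ (Fin (d + 1))) := by
    apply Module.nontrivial_of_finrank_pos (R := ℝ)
    simp
  have hfc := hf.continuousOn.mono hG
  have hT : IsClosed {z : EuclideanSpace ℝ (Fin (d + 1)) | r ≤ ‖z‖} :=
    isClosed_le continuous_const continuous_norm
  obtain ⟨g, hgm, hgfin, hg⟩ :=
    exists_isSegmentUpperGradient (Nat.succ_pos d) hp hfld.lOne hG hfc hT hfin
  have hw : LipschitzWith 1 fun z : EuclideanSpace ℝ (Fin (d + 1)) => max ‖z‖ r :=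
    lipschitzWith_one_norm.max_const r
  have hgrad := hg _ hw _ Subset.rfl fun x _ hxT => by
    have hx : ‖f x‖ < r := by simpa using hxT
    have hc : ContinuousAt (fun z : EuclideanSpace ℝ (Fin (d + 1)) => ‖z‖) (f x) := by fun_prop
    filter_upwards [hc.eventually_lt_const hx] with z hz
    rw [max_eq_right hz.le, max_eq_right hx.le]
  have hfreq := (frequently_abs_sub_le hd x₀ hgm hgfin hR zero_lt_one).mono
    fun t ht => ht _ hgrad
  by_contra hnot
  obtain ⟨M₀, hM₀⟩ : ∃ M₀ : ℝ, ∃ᶠ x in 𝓝[≠] x₀, ‖f x‖ < M₀ := by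
    by_contra hcon
    simp only [not_exists, not_frequently, not_lt] at hcon
    exact hnot (tendsto_atTop.2 hcon)
  set M := max M₀ (r + 1) with hM
  have hcases : ∃ᶠ t in 𝓝[>] (0 : ℝ),
      (∀ x, supNorm (x - x₀) = t → dist (f x) 0 ≤ M + 1) ∨
      ∀ x, supNorm (x - x₀) = t → f x ∉ Metric.ball 0 M := by
    refine hfreq.mono fun t ht => ?_
    by_contra hcon
    simp only [not_or, not_forall, not_le, not_not, Metric.mem_ball, dist_zero_right] at hcon
    obtain ⟨⟨a, ha, hay⟩, b, hb, hby⟩ := hcon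
    have h1 := (le_abs_self _).trans (ht b a hb ha)
    have h2 : M + 1 < max ‖f a‖ r := lt_max_of_lt_left hay
    have h3 : max ‖f b‖ r < M := max_lt hby ((lt_add_one r).trans_le (le_max_right _ _))
    linarith
  rcases frequently_or_distrib.1 hcases with hA | hB
  · obtain ⟨ρ, hρ0, -, hρ⟩ := exists_forall_mem_puncturedCube_le hfc
      (hf.isOpen_image_puncturedCube hG) hR (φ := fun z => dist z 0) (by fun_prop)
      (frequently_dist_lt 0) hA
    obtain ⟨x, hx, hxρ⟩ :=
      ((hhit (M + 1)).and_eventually (puncturedCube_mem_nhdsNE x₀ hρ0)).exists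
    have := hρ x hxρ
    rw [dist_zero_right] at this
    linarith
  · refine false_of_frequently_notMem (Nat.succ_pos d) hp hf hfld hR hG hT hfin
      (convex_ball 0 M).isPreconnected ?_ hB (hM₀.mono fun x hx => ?_)
    · have hopen : IsOpen {z : EuclideanSpace ℝ (Fin (d + 1)) | r < ‖z‖ ∧ ‖z‖ < M} :=
        (isOpen_lt continuous_const continuous_norm).inter
          (isOpen_lt continuous_norm continuous_const)
      obtain ⟨z, hz⟩ := exists_norm_eq (EuclideanSpace ℝ (Fin (d + 1)))
        (show 0 ≤ r + 1 / 2 by positivity)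
      have hrM : r + 1 ≤ M := le_max_right _ _
      have hpos := hopen.measure_pos volume ⟨z, by
        rw [mem_ofPred_eq, hz]; constructor <;> linarith⟩
      refine (hpos.trans_le (measure_mono fun z hz => ?_)).ne'
      exact ⟨by simpa using hz.2, hz.1.le⟩
    · rw [mem_ball_zero_iff]
      exact hx.trans_le (le_max_left M₀ (r + 1))

/-- The integral of the inner dilatation of `f` on a punctured cube diverges near each cluster
value, if the singularity is essential. -/
theorem lintegral_innerDil_puncturedCube_eq_top (hn : 2 ≤ n) (hp : (n : ℝ) ≤ p)
    (hf : OpenDiscreteOn f G) (hfld : FiniteLengthDistortion p q f G) (hR : 0 < R)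
    (hG : puncturedCube x₀ R ⊆ G) (hess : IsEssentialSingularity f x₀)
    {y₀ : OnePoint (EuclideanSpace ℝ (Fin n))} (hy₀ : y₀ ∈ clusterSet f G x₀) (hx₀ : x₀ ∉ G)
    {U : Set (OnePoint (EuclideanSpace ℝ (Fin n)))} (hU : U ∈ 𝓝 y₀) :
    ∫⁻ y in {y : EuclideanSpace ℝ (Fin n) | (y : OnePoint (EuclideanSpace ℝ (Fin n))) ∈ U},
      innerDil p f (puncturedCube x₀ R) y = ∞ := by
  by_contra hne
  have hfc := hf.continuousOn.mono hG
  have hp0 : 0 ≤ p := (Nat.cast_nonneg n).trans hp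
  have hfin : ∀ T : Set (EuclideanSpace ℝ (Fin n)), IsClosed T →
      (∀ y ∈ T, (y : OnePoint (EuclideanSpace ℝ (Fin n))) ∈ U) →
      ∫⁻ x in puncturedCube x₀ R ∩ f ⁻¹' T, derivNorm f x ^ p < ∞ := by
    intro T hT hTU
    calc _ ≤ ∫⁻ y in T, innerDil p f (puncturedCube x₀ R ∩ f ⁻¹' T) y :=
          lintegral_derivNorm_rpow_le_lintegral_innerDil hfld.ae_differentiable hfld.luzinNInv
            (measurableSet_puncturedCube_inter_preimage hfc hT) (inter_subset_left.trans hG)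
            hT.measurableSet (fun x hx => hx.2) hp0
      _ ≤ ∫⁻ y in T, innerDil p f (puncturedCube x₀ R) y :=
          lintegral_mono fun y => innerDil_mono p f inter_subset_left y
      _ ≤ _ := lintegral_mono_set hTU
      _ < ∞ := lt_top_iff_ne_top.2 hne
  have hhit : ∀ V ∈ 𝓝 y₀, ∃ᶠ x in 𝓝[≠] x₀, (f x : OnePoint (EuclideanSpace ℝ (Fin n))) ∈ V := by
    obtain ⟨u, huG, hu, huy⟩ := hy₀
    intro V hV
    have hu' : Tendsto u atTop (𝓝[≠] x₀) :=
      tendsto_nhdsWithin_iff.2 ⟨hu, .of_forall fun k hk => hx₀ (by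
        rw [mem_singleton_iff] at hk; exact hk ▸ huG k)⟩
    exact hu'.frequently (huy.eventually hV).frequently
  induction y₀ using OnePoint.rec with
  | coe y =>
    have hUy : ∀ᶠ z : EuclideanSpace ℝ (Fin n) in 𝓝 y,
        (z : OnePoint (EuclideanSpace ℝ (Fin n))) ∈ U :=
      OnePoint.continuous_coe.continuousAt.eventually_mem hU
    obtain ⟨r, hr, hrU⟩ := Metric.nhds_basis_closedBall.eventually_iff.1 hUy
    have hopen : (fun z : EuclideanSpace ℝ (Fin n) => (z : OnePoint (EuclideanSpace ℝ (Fin n)))) ''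
        Metric.ball y (r / 2) ∈ 𝓝 (y : OnePoint (EuclideanSpace ℝ (Fin n))) :=
      OnePoint.isOpenEmbedding_coe.image_mem_nhds.2 (Metric.ball_mem_nhds y (by positivity))
    obtain ⟨a, ha⟩ := exists_tendsto_of_frequently_mem_ball hn hp hf hfld hR hG hr
      (hfin _ Metric.isClosed_closedBall fun z hz => hrU hz)
      ((hhit _ hopen).mono fun x hx => by
        obtain ⟨z, hz, hzx⟩ := hx
        rwa [← OnePoint.coe_injective hzx])
    exact hess ⟨a, (OnePoint.continuous_coe.tendsto a).comp ha⟩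
  | infty =>
    have hcoe : Tendsto (fun z : EuclideanSpace ℝ (Fin n) =>
        (z : OnePoint (EuclideanSpace ℝ (Fin n)))) (cocompact _) (𝓝 OnePoint.infty) := by
      rw [← coclosedCompact_eq_cocompact]
      exact OnePoint.tendsto_coe_infty
    have hUev := hcoe.eventually_mem hU
    rw [← Metric.cobounded_eq_cocompact, ← comap_norm_atTop, eventually_comap] at hUev
    obtain ⟨r, hr⟩ := eventually_atTop.1 hUev
    have hlim := tendsto_norm_atTop_of_frequently_lt_norm hn hp hf hfld hR hG
      (le_max_right r 0) (hfin {z | max r 0 ≤ ‖z‖} (isClosed_le continuous_const continuous_norm)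
        fun z hz => hr ‖z‖ ((le_max_left _ _).trans hz) z rfl) fun M => by
        have hV := (OnePoint.isOpen_compl_image_coe.2
          ⟨Metric.isClosed_closedBall,
            isCompact_closedBall (0 : EuclideanSpace ℝ (Fin n)) M⟩).mem_nhds
            OnePoint.infty_notMem_image_coe
        refine (hhit _ hV).mono fun x hx => ?_
        by_contra hle
        exact hx ⟨f x, by simpa using hle, rfl⟩
    refine hess ⟨OnePoint.infty, hcoe.comp ?_⟩
    rw [← Metric.cobounded_eq_cocompact, ← comap_norm_atTop]
    exact tendsto_comap_iff.2 hlim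

theorem exists_puncturedCube_subset {V : Set (EuclideanSpace ℝ (Fin n))} (hV : V ∈ 𝓝 x₀) :
    ∃ R, 0 < R ∧ puncturedCube x₀ R ⊆ V \ {x₀} := by
  obtain ⟨ε, hε, hεV⟩ := Metric.mem_nhds_iff.1 hV
  refine ⟨ε / (n + 1), by positivity, fun x hx => ⟨hεV ?_, ?_⟩⟩
  · have h1 := puncturedCube_subset_closedBall x₀ _ hx
    refine lt_of_le_of_lt (Metric.mem_closedBall.1 h1) ?_
    rw [mul_div_assoc', div_lt_iff₀ (by positivity)]
    nlinarith
  · rintro rfl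
    exact (hx.1.trans_eq (by simp [supNorm])).false

end ClusterPoints

theorem theorem1 (n : ℕ) (hn : 2 ≤ n) (p q : ℝ) (hp : (n : ℝ) ≤ p) (hq : 1 ≤ q)
    (D : Set (EuclideanSpace ℝ (Fin n))) (hDo : IsOpen D) (hDc : IsConnected D)
    (x₀ : EuclideanSpace ℝ (Fin n)) (hx₀ : x₀ ∈ D)
    (f : EuclideanSpace ℝ (Fin n) → EuclideanSpace ℝ (Fin n))
    (hf : OpenDiscreteOn f (D \ {x₀}))
    (hfld : FiniteLengthDistortion p q f (D \ {x₀}))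
    (c : ℝ) (hc : 0 < c)
    (hK : ∀ᵐ y, y ∈ f '' (D \ {x₀}) → ENNReal.ofReal c ≤ innerDil p f (D \ {x₀}) y)
    (hess : IsEssentialSingularity f x₀) :
    (∀ y₀ ∈ clusterSet f (D \ {x₀}) x₀, ∀ U ∈ 𝓝 y₀,
      ∫⁻ y in {y : EuclideanSpace ℝ (Fin n) | (y : OnePoint (EuclideanSpace ℝ (Fin n))) ∈ U},
        innerDil p f (D \ {x₀}) y = ∞) ∧
    (∀ V ∈ 𝓝 x₀, V ⊆ D → ∀ Q : EuclideanSpace ℝ (Fin n) → ℝ≥0∞, AEMeasurable Q volume →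
      (∃ y₀ ∈ clusterSet f (D \ {x₀}) x₀, ∃ U ∈ 𝓝 y₀,
        ∫⁻ y in {y : EuclideanSpace ℝ (Fin n) | (y : OnePoint (EuclideanSpace ℝ (Fin n))) ∈ U},
          Q y < ∞) →
      (∀ᵐ y, y ∈ f '' (V \ {x₀}) →
        innerDil p f (V \ {x₀}) y ≤ Q y * (mapMultiplicity f (V \ {x₀}) y : ℝ≥0∞)) →
      ¬ ∃ M : ℕ, ∀ y, mapMultiplicity f (V \ {x₀}) y ≤ M) := by
  have hx₀G : x₀ ∉ D \ {x₀} := fun h => h.2 rfl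
  refine ⟨fun y₀ hy₀ U hU => ?_, fun V hV hVD Q _ hQ hKQ => ?_⟩
  · obtain ⟨R, hR, hRD⟩ := exists_puncturedCube_subset (hDo.mem_nhds hx₀)
    have h := lintegral_innerDil_puncturedCube_eq_top hn hp hf hfld hR hRD hess hy₀ hx₀G hU
    exact top_le_iff.1 (h.symm.le.trans (lintegral_mono fun y => innerDil_mono p f hRD y))
  · rintro ⟨M, hM⟩
    obtain ⟨y₀, hy₀, U, hU, hQU⟩ := hQ
    obtain ⟨R, hR, hRV⟩ := exists_puncturedCube_subset hV
    have h := lintegral_innerDil_puncturedCube_eq_top hn hp hf hfld hR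
      (hRV.trans (sdiff_subset_sdiff_left hVD)) hess hy₀ hx₀G hU
    have hle : ∀ᵐ y, innerDil p f (puncturedCube x₀ R) y ≤ M * Q y := by
      filter_upwards [hKQ] with y hy
      refine (innerDil_mono p f hRV y).trans ?_
      by_cases hyV : y ∈ f '' (V \ {x₀})
      · refine (hy hyV).trans ?_
        rw [mul_comm]
        have hMy : (mapMultiplicity f (V \ {x₀}) y : ℝ≥0∞) ≤ M := by exact_mod_cast hM y
        gcongr
      · have : IsEmpty ↥((V \ {x₀}) ∩ f ⁻¹' {y}) :=
          ⟨fun x => hyV ⟨x, x.2.1, x.2.2⟩⟩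
        simp [innerDil]
    have hlt := (lintegral_mono_ae (ae_restrict_of_ae hle)).trans_lt
      ((lintegral_const_mul' (M : ℝ≥0∞) Q (ENNReal.natCast_ne_top M)).trans_lt
        (ENNReal.mul_lt_top (ENNReal.natCast_lt_top M) hQU))
    exact hlt.ne h
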